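/- Let $X$ be a standard Borel space and let $\mu$ be a non-atomic Borel probability measure on $X$. Let $\mathrm{Aut}^*(X,\mu)$ be the group of all Borel automorphisms $T$ of $X$ that preserve the measure class of $\mu$ (that is, $\mu(T^{-1}A)=0$ if and only if $\mu(A)=0$, for every Borel set $A$), where two automorphisms that agree $\mu$-almost everywhere are identified. Equip it with the strong topology, i.e. the topology induced by the strong operator topology on $L^2(X,\mu)$ through $$\Phi(T)f(x)=\Big(\frac{d(\mu\circ T^{-1})}{d\mu}(x)\Big)^{1/2} f(T^{-1}x).$$ Then $G=\mathrm{Aut}^*(X,\mu)$ is a Lévy group, and it is extremely amenable. Here: * A metrizable topological group $G$ is a *Lévy group* if there is a net $(G_\alpha)_{\alpha\in A}$ of compact subgroups of $G$, with normalized Haar measures $\mu_\alpha$ (regarded as measures on $G$), such that for any right-invariant metric $d$ inducing the topology of $G$ (such metrics exist): (1) whenever $A_\alpha\subseteq G$ are Borel sets with $\liminf_\alpha\mu_\alpha(A_\alpha)>0$, then $\lim_\alpha\mu_\alpha(\{x : d(x,A_\alpha)<\varepsilon\})=1$ for every $\varepsilon>0$; and (2) for all $g_1,\dots,g_N\in G$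 and every $\varepsilon>0$ there is $\alpha\in A$ such that $d(g_i,G_\beta)<\varepsilon$ for all $\beta\ge\alpha$ and all $i=1,\dots,N$. * A topological group $G$ is *extremely amenable* if every continuous action of $G$ on a nonempty compact Hausdorff space has a fixed point. -/

import Mathlib

open MeasureTheory Filter Topology
open scoped ENNReal

universe v u

noncomputable section

/-! ### Lévy families, Lévy groups, extreme amenability -/

/-- A net `(X i, d i, μ i)` of mm-spaces (metric spaces carrying a Borel probability measure) is a
Lévy family if, whenever `A i ⊆ X i` are Borel with `liminf μ i (A i) > 0`, then for each `ε > 0`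
the measures of the open `ε`-neighbourhoods of the `A i` tend to `1`. -/
def IsLevyFamily {ι : Type*} [Preorder ι] {X : ι → Type*} [∀ i, MetricSpace (X i)]
    [∀ i, MeasurableSpace (X i)] (μ : ∀ i, Measure (X i)) : Prop :=
  ∀ A : ∀ i, Set (X i), (∀ i, MeasurableSet (A i)) →
    0 < liminf (fun i => μ i (A i)) atTop →
    ∀ ε : ℝ, 0 < ε → Tendsto (fun i => μ i (Metric.thickening ε (A i))) atTop (𝓝 1)

/-- A metric on the topological group `G` that induces the given topology and is invariant under
right translations. -/
structure IsCompatibleRightInvariant {G : Type*} [Group G] [t : TopologicalSpace G]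
    (d : MetricSpace G) : Prop where
  topology_eq : d.toPseudoMetricSpace.toUniformSpace.toTopologicalSpace = t
  dist_mul_right : ∀ a b c : G, d.dist (a * c) (b * c) = d.dist a b

/-- `μ` is the normalized Haar measure of the subgroup `H`, regarded as a measure on `G`. -/
def IsNormalizedHaarOn {G : Type*} [Group G] [TopologicalSpace G] [MeasurableSpace G]
    (H : Subgroup G) (μ : Measure G) : Prop :=
  ∃ ν : Measure H, ν.IsHaarMeasure ∧ IsProbabilityMeasure ν ∧ μ = ν.map (fun h : H => (h : G))

/-- Lévy groups: metrizable topological groups with a net of compact subgroups whose normalized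
Haar measures form a Lévy family and which eventually come close to every finite set, both for any
compatible right-invariant metric. (The field `exists_metric` makes explicit that such metrics
exist, so that the last field is not vacuous.) -/
structure IsLevyGroup (G : Type u) [Group G] [TopologicalSpace G] [MeasurableSpace G]
    [BorelSpace G] : Prop where
  isTopologicalGroup : IsTopologicalGroup G
  metrizable : TopologicalSpace.MetrizableSpace G
  exists_metric : ∃ d : MetricSpace G, IsCompatibleRightInvariant d
  exists_net : ∃ (ι : Type u) (_ : Preorder ι) (_ : IsDirectedOrder ι) (_ : Nonempty ι)
    (H : ι → Subgroup G) (μ : ι → Measure G),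
    (∀ i, IsCompact (H i : Set G)) ∧ (∀ i, IsNormalizedHaarOn (H i) (μ i)) ∧
    ∀ d : MetricSpace G, IsCompatibleRightInvariant d →
      @IsLevyFamily ι _ (fun _ => G) (fun _ => d) _ μ ∧
      ∀ (F : Finset G) (ε : ℝ), 0 < ε →
        ∃ i, ∀ j, i ≤ j → ∀ g ∈ F, ∃ h ∈ H j, d.dist g h < ε

/-- `G` is extremely amenable: every continuous action of `G` on a nonempty compact Hausdorff space
has a fixed point. -/
def ExtremelyAmenable (G : Type u) [Group G] [TopologicalSpace G] : Prop :=
  ∀ (K : Type v) [TopologicalSpace K] [CompactSpace K] [T2Space K] [Nonempty K]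
    [MulAction G K] [ContinuousSMul G K], ∃ x : K, ∀ g : G, g • x = x

/-! ### The group of measure class preserving automorphisms -/

section AutStar

variable {X : Type*}

lemma perm_apply_inv (T : Equiv.Perm X) (x : X) : T (T⁻¹ x) = x := T.apply_symm_apply x

lemma perm_inv_apply (T : Equiv.Perm X) (x : X) : T⁻¹ (T x) = x := T.symm_apply_apply x

variable [MeasurableSpace X]

/-- The group of non-singular automorphisms of `(X, μ)`: bijections `T` of `X` such that `T` and
`T⁻¹` are measurable and pull `μ`-null sets back to `μ`-null sets. -/
def nonsingularGroup (μ : Measure X) : Subgroup (Equiv.Perm X) where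
  carrier := {T | Measure.QuasiMeasurePreserving T μ μ ∧
    Measure.QuasiMeasurePreserving (T⁻¹ : Equiv.Perm X) μ μ}
  one_mem' := ⟨.id μ, by rw [inv_one]; exact .id μ⟩
  mul_mem' := by
    rintro S T ⟨hS, hS'⟩ ⟨hT, hT'⟩
    refine ⟨hS.comp hT, ?_⟩
    rw [mul_inv_rev]
    exact hT'.comp hS'
  inv_mem' := by
    rintro T ⟨hT, hT'⟩
    exact ⟨hT', by rwa [inv_inv]⟩

/-- The normal subgroup of the automorphisms that are almost everywhere equal to the identity. -/
def aeTrivialSubgroup (μ : Measure X) : Subgroup (nonsingularGroup μ) where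
  carrier := {T | ∀ᵐ x ∂μ, (T : Equiv.Perm X) x = x}
  one_mem' := Eventually.of_forall (f := ae μ) fun _ => rfl
  mul_mem' := by
    intro S T hS hT
    filter_upwards [hT, T.2.1.ae hS] with x h1 h2
    rw [Subgroup.coe_mul, Equiv.Perm.mul_apply, h2, h1]
  inv_mem' := by
    intro T hT
    filter_upwards [T.2.2.ae hT] with x h
    rw [perm_apply_inv] at h
    simpa using h.symm

instance aeTrivialSubgroup_normal (μ : Measure X) : (aeTrivialSubgroup μ).Normal where
  conj_mem := by
    intro T hT S
    filter_upwards [S.2.2.ae hT] with x h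
    simp only [Subgroup.coe_mul, Equiv.Perm.mul_apply, InvMemClass.coe_inv, h,
      perm_apply_inv]

/-- `Aut*(X, μ)`: non-singular automorphisms of `(X, μ)`, two of them being identified when they
agree almost everywhere. -/
def AutStar (μ : Measure X) : Type _ := nonsingularGroup μ ⧸ aeTrivialSubgroup μ

instance (μ : Measure X) : Group (AutStar μ) :=
  inferInstanceAs (Group (nonsingularGroup μ ⧸ aeTrivialSubgroup μ))

/-- The function `x ↦ (d(μ ∘ T⁻¹)/dμ (x)) ^ (1/2) * f (T⁻¹ x)`; note that `μ ∘ T⁻¹` is the image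
measure of `μ` under `T`. -/
def koopmanFun (μ : Measure X) (T : Equiv.Perm X) (f : X → ℂ) (x : X) : ℂ :=
  (Real.sqrt ((μ.map T).rnDeriv μ x).toReal : ℂ) * f (T⁻¹ x)

variable {μ : Measure X}

lemma koopmanFun_congr {S T : Equiv.Perm X} (hS : S ∈ nonsingularGroup μ)
    (hST : ∀ᵐ x ∂μ, S x = T x) (hST' : ∀ᵐ x ∂μ, S⁻¹ x = T⁻¹ x) {f g : X → ℂ} (hfg : f =ᵐ[μ] g) :
    koopmanFun μ S f =ᵐ[μ] koopmanFun μ T g := by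
  filter_upwards [hST', hS.2.ae hfg] with x h1 h2
  rw [koopmanFun, koopmanFun, Measure.map_congr hST, h2, h1]

lemma aestronglyMeasurable_koopmanFun {T : Equiv.Perm X} (hT : T ∈ nonsingularGroup μ)
    {f : X → ℂ} (hf : AEStronglyMeasurable f μ) : AEStronglyMeasurable (koopmanFun μ T f) μ := by
  refine AEStronglyMeasurable.mul ?_ (hf.comp_quasiMeasurePreserving hT.2)
  exact (Complex.measurable_ofReal.comp
    ((Measure.measurable_rnDeriv _ _).ennreal_toReal.sqrt)).aestronglyMeasurable

lemma eLpNorm_koopmanFun [IsFiniteMeasure μ] {T : Equiv.Perm X} (hT : T ∈ nonsingularGroup μ)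
    {f : X → ℂ} (hf : AEStronglyMeasurable f μ) :
    eLpNorm (koopmanFun μ T f) 2 μ = eLpNorm f 2 μ := by
  rw [eLpNorm_eq_lintegral_rpow_enorm_toReal (by simp) (by simp),
    eLpNorm_eq_lintegral_rpow_enorm_toReal (by simp) (by simp)]
  congr 1
  have hm : AEMeasurable (fun x => ‖f (T⁻¹ x)‖ₑ ^ (2 : ℝ≥0∞).toReal) μ :=
    ((hf.comp_quasiMeasurePreserving hT.2).enorm).pow_const _
  have hmf : AEMeasurable (fun x => ‖f (T⁻¹ x)‖ₑ ^ (2 : ℝ≥0∞).toReal) (μ.map T) :=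
    hm.mono_ac hT.1.absolutelyContinuous
  calc ∫⁻ x, ‖koopmanFun μ T f x‖ₑ ^ (2 : ℝ≥0∞).toReal ∂μ
      = ∫⁻ x, (μ.map T).rnDeriv μ x * ‖f (T⁻¹ x)‖ₑ ^ (2 : ℝ≥0∞).toReal ∂μ := by
        refine lintegral_congr_ae ?_
        filter_upwards [Measure.rnDeriv_lt_top (μ.map T) μ] with x hx
        rw [koopmanFun, enorm_mul, ENNReal.mul_rpow_of_nonneg _ _ (by simp)]
        congr 1
        rw [← ofReal_norm, Complex.norm_real, Real.norm_of_nonneg (Real.sqrt_nonneg _)]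
        simp only [ENNReal.toReal_ofNat, ENNReal.rpow_ofNat]
        rw [← ENNReal.ofReal_pow (Real.sqrt_nonneg _), Real.sq_sqrt ENNReal.toReal_nonneg,
          ENNReal.ofReal_toReal hx.ne]
    _ = ∫⁻ x, ‖f (T⁻¹ x)‖ₑ ^ (2 : ℝ≥0∞).toReal ∂(μ.map T) :=
        lintegral_rnDeriv_mul hT.1.absolutelyContinuous hm
    _ = ∫⁻ x, ‖f x‖ₑ ^ (2 : ℝ≥0∞).toReal ∂μ := by
        rw [lintegral_map' hmf hT.1.measurable.aemeasurable]
        simp only [perm_inv_apply]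

lemma memLp_koopmanFun [IsFiniteMeasure μ] (T : nonsingularGroup μ) (f : Lp ℂ 2 μ) :
    MemLp (koopmanFun μ T f) 2 μ :=
  ⟨aestronglyMeasurable_koopmanFun T.2 (Lp.aestronglyMeasurable f), by
    rw [eLpNorm_koopmanFun T.2 (Lp.aestronglyMeasurable f)]; exact Lp.eLpNorm_lt_top f⟩

/-- The linear isometry `Φ(T)` of `L²(X, μ)` attached to a non-singular automorphism `T`. -/
def koopman [IsFiniteMeasure μ] (T : nonsingularGroup μ) : Lp ℂ 2 μ →ₗᵢ[ℂ] Lp ℂ 2 μ where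
  toFun f := (memLp_koopmanFun T f).toLp _
  map_add' f g := by
    rw [← MemLp.toLp_add, MemLp.toLp_eq_toLp_iff]
    filter_upwards [T.2.2.ae (Lp.coeFn_add f g)] with x h
    simp only [koopmanFun, Pi.add_apply, h, mul_add]
  map_smul' c f := by
    rw [RingHom.id_apply, ← MemLp.toLp_const_smul, MemLp.toLp_eq_toLp_iff]
    filter_upwards [T.2.2.ae (Lp.coeFn_smul c f)] with x h
    simp only [koopmanFun, Pi.smul_apply, h, smul_eq_mul, mul_left_comm]
  norm_map' f := by
    change ‖(memLp_koopmanFun T f).toLp _‖ = ‖f‖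
    rw [Lp.norm_toLp, eLpNorm_koopmanFun T.2 (Lp.aestronglyMeasurable f), Lp.norm_def]

lemma koopman_eq_of_rel [IsFiniteMeasure μ] {S T : nonsingularGroup μ}
    (h : S⁻¹ * T ∈ aeTrivialSubgroup μ) : koopman S = koopman T := by
  have h1 : ∀ᵐ x ∂μ, (S : Equiv.Perm X) x = (T : Equiv.Perm X) x := by
    filter_upwards [h] with x hx
    simp only [Subgroup.coe_mul, Equiv.Perm.mul_apply, InvMemClass.coe_inv] at hx
    rw [Equiv.Perm.inv_eq_iff_eq] at hx
    exact hx.symm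
  have h2 : ∀ᵐ x ∂μ, (S : Equiv.Perm X)⁻¹ x = (T : Equiv.Perm X)⁻¹ x := by
    filter_upwards [T.2.2.ae h1] with x hx
    rw [perm_apply_inv] at hx
    rw [Equiv.Perm.inv_eq_iff_eq, hx]
  ext1 f
  exact (MemLp.toLp_eq_toLp_iff (memLp_koopmanFun S f) (memLp_koopmanFun T f)).2
    (koopmanFun_congr S.2 h1 h2 .rfl)

/-- `Φ` on classes of automorphisms modulo almost everywhere equality. -/
def AutStar.koopman [IsFiniteMeasure μ] : AutStar μ → Lp ℂ 2 μ →ₗᵢ[ℂ] Lp ℂ 2 μ :=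
  Quotient.lift _root_.koopman fun _ _ h => koopman_eq_of_rel (QuotientGroup.leftRel_apply.1 h)

/-- The strong topology: the topology induced through `Φ` by the strong operator topology, that is,
by pointwise convergence on `L²(X, μ)` in norm. -/
instance [IsFiniteMeasure μ] : TopologicalSpace (AutStar μ) :=
  .induced (fun T (f : Lp ℂ 2 μ) => AutStar.koopman T f) Pi.topologicalSpace

instance [IsFiniteMeasure μ] : MeasurableSpace (AutStar μ) := borel _

instance [IsFiniteMeasure μ] : BorelSpace (AutStar μ) := ⟨rfl⟩

end AutStar

end

/-! Both conclusions follow from `HasConcentratedPerms`: any finite subset of the group is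
approximated by the image of a finite symmetric group in which every set of non-negligible
proportion has an almost full neighbourhood.

Approximation (`exists_permModel_near`). A strong neighbourhood sees only finitely many indicators
1_C, and Φ(S)1_C is close to Φ(T)1_C once, off a small set, S⁻¹y and T⁻¹y lie on the same side of C
and the density of S is not much below that of T (`norm_koopman_indicator_sub_sq_le`). Partition X
into finitely many cells on which these sides are constant and, apart from extreme values, the
densities of the given automorphisms are constant up to a factor r close to 1. If T⁻¹ multiplies
masses on a cell by about r^s, permuting pieces of equal mass cannot imitate it; so each cell is cut
into pieces of masses about w, wr, ..., wr^(M-1), each scale taking the share 1/M of the cell. A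
piece is then moved s scales up. Comparing masses shows that there are enough targets at every
scale, and when |s| ≤ L at most the fraction L/M of the pieces falls off the ends
(`PieceSystem.exists_perm`, `PieceSystem.sum_out_of_range_le`).

Concentration. There are at most 1/w pieces, of mass at most b = w r^M, so b² · #J tends to 0 with w
while r and M stay fixed. A b-Lipschitz function for the Hamming distance on the symmetric group has
variance at most 9 b² #J (`sum_perm_sub_finAvg_sq_le`), and Chebyshev's inequality gives
concentration (`card_near_le`). The bound ‖Φ(σ)1_C − 1_C‖² ≤ 2b · #{moved pieces} carries it to the
strong topology.

Consequences. Enlarging the finite set and shrinking the proportions gives the Lévy net. For extreme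
amenability, concentration puts most of the points φ(σ)x₀ of a compact space near a single point,
which yields almost fixed points; compactness then yields a fixed one. -/

noncomputable section

/-! ### The Koopman representation and the group topology -/

section Koopman

variable {X : Type*} [MeasurableSpace X] {μ : Measure X}

/-- A non-singular automorphism as a measurable equivalence. -/
def nonsingularEquiv (T : nonsingularGroup μ) : X ≃ᵐ X where
  toEquiv := (T : Equiv.Perm X)
  measurable_toFun := T.2.1.measurable
  measurable_invFun := T.2.2.measurable

lemma measurableEmbedding_nonsingular (T : nonsingularGroup μ) :
    MeasurableEmbedding (T : Equiv.Perm X) :=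
  (nonsingularEquiv T).measurableEmbedding

namespace AutStar

/-- The class of a non-singular automorphism in `AutStar μ`. -/
def mk : nonsingularGroup μ →* AutStar μ := QuotientGroup.mk' (aeTrivialSubgroup μ)

lemma mk_surjective : Function.Surjective (mk : nonsingularGroup μ →* AutStar μ) :=
  QuotientGroup.mk'_surjective _

lemma mk_eq_one {T : nonsingularGroup μ} :
    mk T = 1 ↔ ∀ᵐ x ∂μ, (T : Equiv.Perm X) x = x :=
  QuotientGroup.eq_one_iff T

end AutStar

variable [IsFiniteMeasure μ]

/-- Chain rule through the intermediate measure S_*μ: the density of S_*T_*μ with respect to S_*μ at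
Sx is that of T_*μ with respect to μ at x. This cocycle identity makes Φ multiplicative. -/
lemma rnDeriv_map_mul (S T : nonsingularGroup μ) :
    (μ.map ((S * T : nonsingularGroup μ) : Equiv.Perm X)).rnDeriv μ =ᵐ[μ] fun x =>
      (μ.map (S : Equiv.Perm X)).rnDeriv μ x *
        (μ.map (T : Equiv.Perm X)).rnDeriv μ ((S : Equiv.Perm X)⁻¹ x) := by
  have hmap : μ.map ((S * T : nonsingularGroup μ) : Equiv.Perm X) =
      (μ.map (T : Equiv.Perm X)).map (S : Equiv.Perm X) := by
    rw [Measure.map_map S.2.1.measurable T.2.1.measurable]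
    rfl
  have h1 := (measurableEmbedding_nonsingular S).rnDeriv_map (μ.map (T : Equiv.Perm X)) μ
  have hac : (μ.map (T : Equiv.Perm X)).map (S : Equiv.Perm X) ≪ μ.map (S : Equiv.Perm X) :=
    T.2.1.absolutelyContinuous.map S.2.1.measurable
  have h2 := Measure.rnDeriv_mul_rnDeriv (κ := μ) hac
  rw [hmap]
  filter_upwards [h2, S.2.2.ae h1] with x hx hx'
  rw [← hx, Pi.mul_apply, mul_comm, ← hx', perm_apply_inv]

lemma koopmanFun_mul (S T : nonsingularGroup μ) (f : X → ℂ) :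
    koopmanFun μ ((S * T : nonsingularGroup μ) : Equiv.Perm X) f =ᵐ[μ]
      koopmanFun μ (S : Equiv.Perm X) (koopmanFun μ (T : Equiv.Perm X) f) := by
  filter_upwards [rnDeriv_map_mul S T] with x hx
  simp only [koopmanFun]
  rw [hx, ENNReal.toReal_mul, Real.sqrt_mul ENNReal.toReal_nonneg, Complex.ofReal_mul, mul_assoc,
    Subgroup.coe_mul, mul_inv_rev, Equiv.Perm.mul_apply]

lemma koopman_coeFn (T : nonsingularGroup μ) (f : Lp ℂ 2 μ) :
    koopman T f =ᵐ[μ] koopmanFun μ (T : Equiv.Perm X) f :=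
  MemLp.coeFn_toLp (memLp_koopmanFun T f)

lemma koopman_mul (S T : nonsingularGroup μ) (f : Lp ℂ 2 μ) :
    koopman (S * T) f = koopman S (koopman T f) := by
  refine Lp.ext ?_
  refine (koopman_coeFn _ _).trans ((koopmanFun_mul S T f).trans ?_)
  refine (koopmanFun_congr S.2 (.of_forall fun _ => rfl) (.of_forall fun _ => rfl) ?_).trans (koopman_coeFn _ _).symm
  exact (koopman_coeFn _ _).symm

lemma koopman_one (f : Lp ℂ 2 μ) : koopman (1 : nonsingularGroup μ) f = f := by
  refine Lp.ext ?_
  refine (koopman_coeFn _ _).trans ?_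
  have h : μ.map ((1 : nonsingularGroup μ) : Equiv.Perm X) = μ := by
    rw [OneMemClass.coe_one, Equiv.Perm.coe_one]
    exact Measure.map_id
  have h2 := Measure.rnDeriv_self μ
  filter_upwards [h2] with x hx
  rw [koopmanFun, h, hx]
  simp

namespace AutStar

lemma koopman_mk (T : nonsingularGroup μ) : (mk T).koopman = _root_.koopman T := rfl

lemma koopman_mul (S T : AutStar μ) (f : Lp ℂ 2 μ) :
    (S * T).koopman f = S.koopman (T.koopman f) := by
  obtain ⟨S, rfl⟩ := mk_surjective S
  obtain ⟨T, rfl⟩ := mk_surjective T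
  rw [← map_mul]
  exact _root_.koopman_mul S T f

lemma koopman_one (f : Lp ℂ 2 μ) : (1 : AutStar μ).koopman f = f := by
  rw [← map_one mk]
  exact _root_.koopman_one f

lemma koopman_apply_inv (S : AutStar μ) (f : Lp ℂ 2 μ) : S.koopman (S⁻¹.koopman f) = f := by
  rw [← koopman_mul, mul_inv_cancel, koopman_one]

lemma continuous_koopman (f : Lp ℂ 2 μ) : Continuous fun S : AutStar μ => S.koopman f :=
  (continuous_apply f).comp continuous_induced_dom

lemma tendsto_nhds_iff {α : Type*} {l : Filter α} {u : α → AutStar μ} {S : AutStar μ} :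
    Tendsto u l (𝓝 S) ↔ ∀ f, Tendsto (fun a => (u a).koopman f) l (𝓝 (S.koopman f)) := by
  rw [nhds_induced, tendsto_comap_iff, tendsto_pi_nhds]
  rfl

/-- All Φ(T) are isometries, so ‖STf − ST₀f‖ = ‖Tf − T₀f‖ and ‖S⁻¹f − T⁻¹f‖ = ‖TS⁻¹f − f‖, which
reduces both continuities to strong convergence at a fixed vector. -/
instance : IsTopologicalGroup (AutStar μ) where
  continuous_mul := by
    refine continuous_iff_continuousAt.2 fun p => ?_
    refine tendsto_nhds_iff.2 fun f => ?_
    have h1 : Tendsto (fun q : AutStar μ × AutStar μ => q.1.koopman (p.2.koopman f)) (𝓝 p)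
        (𝓝 (p.1.koopman (p.2.koopman f))) :=
      ((continuous_koopman _).comp continuous_fst).continuousAt
    have h2 : Tendsto (fun q : AutStar μ × AutStar μ =>
        ‖q.2.koopman f - p.2.koopman f‖) (𝓝 p) (𝓝 0) := by
      have : Continuous fun q : AutStar μ × AutStar μ => ‖q.2.koopman f - p.2.koopman f‖ :=
        (((continuous_koopman f).comp continuous_snd).sub continuous_const).norm
      simpa using this.tendsto p
    have h3 : Tendsto (fun q : AutStar μ × AutStar μ =>
        (q.1 * q.2).koopman f - q.1.koopman (p.2.koopman f)) (𝓝 p) (𝓝 0) := by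
      refine squeeze_zero_norm (fun q => ?_) h2
      rw [koopman_mul, ← map_sub, LinearIsometry.norm_map]
    simpa [koopman_mul] using h3.add h1
  continuous_inv := by
    refine continuous_iff_continuousAt.2 fun S => ?_
    refine tendsto_nhds_iff.2 fun f => ?_
    have h2 : Tendsto (fun T : AutStar μ => ‖T.koopman (S⁻¹.koopman f) - f‖) (𝓝 S) (𝓝 0) := by
      have : Continuous fun T : AutStar μ => ‖T.koopman (S⁻¹.koopman f) - f‖ :=
        ((continuous_koopman _).sub continuous_const).norm
      simpa [koopman_apply_inv] using this.tendsto S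
    have h3 : Tendsto (fun T : AutStar μ => S⁻¹.koopman f - T⁻¹.koopman f) (𝓝 S) (𝓝 0) := by
      refine squeeze_zero_norm (fun T => ?_) h2
      rw [← LinearIsometry.norm_map T.koopman, map_sub, koopman_apply_inv]
    simpa using (tendsto_const_nhds (x := S⁻¹.koopman f)).sub h3

end AutStar

end Koopman

/-! ### Neighbourhoods by indicator functions, and a right-invariant metric -/

section Nhds

/-- An ε/3 argument: isometries are equicontinuous, so strong convergence need only be checked on a
dense set. -/
lemma isClosed_setOf_tendsto_linearIsometry {α E : Type*} [NormedAddCommGroup E] [NormedSpace ℂ E]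
    (l : Filter α) (u : α → E →ₗᵢ[ℂ] E) (v : E →ₗᵢ[ℂ] E) :
    IsClosed {f | Tendsto (fun a => u a f) l (𝓝 (v f))} := by
  refine isClosed_of_closure_subset fun f hf => ?_
  refine Metric.tendsto_nhds.2 fun ε hε => ?_
  obtain ⟨g, hg, hfg⟩ := Metric.mem_closure_iff.1 hf (ε / 3) (by positivity)
  filter_upwards [Metric.tendsto_nhds.1 hg (ε / 3) (by positivity)] with a ha
  have h1 : dist (u a f) (u a g) = dist f g := (u a).dist_map f g
  have h2 : dist (v g) (v f) = dist g f := v.dist_map g f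
  have := dist_triangle4 (u a f) (u a g) (v g) (v f)
  rw [dist_comm g f] at h2
  linarith

variable {X : Type*} [MeasurableSpace X] {μ : Measure X} [IsFiniteMeasure μ]

/-- The indicator function of a measurable set as an element of `L²`. -/
def indicatorL2 (μ : Measure X) [IsFiniteMeasure μ] {C : Set X} (hC : MeasurableSet C) :
    Lp ℂ 2 μ :=
  indicatorConstLp 2 hC (measure_ne_top μ C) 1

lemma koopman_indicatorL2 (T : nonsingularGroup μ) {C : Set X} (hC : MeasurableSet C) :
    koopman T (indicatorL2 μ hC) =ᵐ[μ] fun x =>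
      (Real.sqrt ((μ.map (T : Equiv.Perm X)).rnDeriv μ x).toReal : ℂ) *
        C.indicator (fun _ => 1) ((T : Equiv.Perm X)⁻¹ x) := by
  refine (koopman_coeFn T _).trans ?_
  filter_upwards [T.2.2.ae (indicatorConstLp_coeFn (p := 2) (hs := hC)
    (hμs := measure_ne_top μ C) (c := (1 : ℂ)))] with x hx
  rw [koopmanFun, indicatorL2, hx]

namespace AutStar

lemma tendsto_nhds_of_indicator {α : Type*} {l : Filter α} {u : α → AutStar μ} {S : AutStar μ}
    (h : ∀ (C : Set X) (hC : MeasurableSet C), Tendsto (fun a => (u a).koopman (indicatorL2 μ hC)) l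
      (𝓝 (S.koopman (indicatorL2 μ hC)))) : Tendsto u l (𝓝 S) := by
  refine tendsto_nhds_iff.2 fun f => ?_
  refine Lp.induction (p := 2) (by simp)
    (fun f : Lp ℂ 2 μ => Tendsto (fun a => (u a).koopman f) l (𝓝 (S.koopman f))) ?_ ?_ ?_ f
  · intro c s hs hμs
    have h1 : (Lp.simpleFunc.indicatorConst 2 hs hμs.ne c : Lp ℂ 2 μ) = c • indicatorL2 μ hs := by
      rw [Lp.simpleFunc.coe_indicatorConst, indicatorL2]
      refine Lp.ext ?_
      filter_upwards [indicatorConstLp_coeFn (p := 2) (hs := hs) (hμs := hμs.ne) (c := c),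
        indicatorConstLp_coeFn (p := 2) (hs := hs) (hμs := hμs.ne) (c := (1 : ℂ)),
        Lp.coeFn_smul c (indicatorConstLp 2 hs hμs.ne (1 : ℂ))] with x h1 h2 h3
      rw [h1, h3, Pi.smul_apply, h2]
      by_cases hx : x ∈ s <;> simp [hx]
    rw [h1]
    simpa only [map_smul] using (h s hs).const_smul c
  · intro f g hf hg _ h1 h2
    simpa only [map_add] using h1.add h2
  · exact isClosed_setOf_tendsto_linearIsometry _ _ _

/-- Neighbourhoods in the strong topology are controlled by finitely many indicator functions. -/
lemma exists_finset_indicator_of_mem_nhds {S : AutStar μ} {W : Set (AutStar μ)} (hW : W ∈ 𝓝 S) :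
    ∃ (F : Finset {C : Set X // MeasurableSet C}) (ε : ℝ), 0 < ε ∧ ∀ T : AutStar μ,
      (∀ C ∈ F, ‖T.koopman (indicatorL2 μ C.2) - S.koopman (indicatorL2 μ C.2)‖ < ε) → T ∈ W := by
  -- The filter `l` is the largest one along which every Φ(T)1_C tends to Φ(S)1_C. It lies below 𝓝
  -- S, and membership in an infimum of filters involves only finitely many C.
  let l : Filter (AutStar μ) := ⨅ C : {C : Set X // MeasurableSet C},
    comap (fun T : AutStar μ => T.koopman (indicatorL2 μ C.2)) (𝓝 (S.koopman (indicatorL2 μ C.2)))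
  have hl : Tendsto id l (𝓝 S) := tendsto_nhds_of_indicator fun C hC =>
    tendsto_comap.mono_left (iInf_le _ (⟨C, hC⟩ : {C : Set X // MeasurableSet C}))
  have hWl : W ∈ l := hl hW
  obtain ⟨F, hF⟩ := (mem_iInf_finite _).1 hWl
  have key : ∀ G : Finset {C : Set X // MeasurableSet C}, ∀ V : Set (AutStar μ),
      V ∈ (⨅ C ∈ G, comap (fun T : AutStar μ => T.koopman (indicatorL2 μ C.2))
        (𝓝 (S.koopman (indicatorL2 μ C.2)))) →
      ∃ ε : ℝ, 0 < ε ∧ ∀ T : AutStar μ,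
        (∀ C ∈ G, ‖T.koopman (indicatorL2 μ C.2) - S.koopman (indicatorL2 μ C.2)‖ < ε) →
          T ∈ V := by
    classical
    intro G
    induction G using Finset.induction_on with
    | empty =>
      intro V hV
      refine ⟨1, one_pos, fun T _ => ?_⟩
      have : V = Set.univ := by simpa using hV
      rw [this]; trivial
    | insert C G _ ih =>
      intro V hV
      rw [Finset.iInf_insert] at hV
      obtain ⟨V1, hV1, V2, hV2, rfl⟩ := mem_inf_iff.1 hV
      obtain ⟨V1', hV1', hsub⟩ := mem_comap.1 hV1
      obtain ⟨ε1, hε1, h1⟩ := Metric.mem_nhds_iff.1 hV1'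
      obtain ⟨ε2, hε2, h2⟩ := ih V2 hV2
      refine ⟨min ε1 ε2, lt_min hε1 hε2, fun T hT => ⟨hsub (h1 ?_), h2 T fun D hD => ?_⟩⟩
      · rw [Metric.mem_ball, dist_eq_norm]
        exact (hT C (Finset.mem_insert_self _ _)).trans_le (min_le_left _ _)
      · exact (hT D (Finset.mem_insert_of_mem hD)).trans_le (min_le_right _ _)
  obtain ⟨ε, hε, h⟩ := key F W hF
  exact ⟨F, ε, hε, h⟩

/-- Comparing supports in Φ(S)1_C = 1_C gives S⁻¹x ∈ C for almost every x ∈ C. A countable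
separating family and its complements then pin down S⁻¹x. -/
lemma eq_one_of_koopman_eq [MeasurableSpace.CountablySeparated X] {S : AutStar μ}
    (h : ∀ f, S.koopman f = f) : S = 1 := by
  obtain ⟨S, rfl⟩ := mk_surjective S
  obtain ⟨A, hA, hsep⟩ := exists_seq_separating X MeasurableSet.univ Set.univ
  have h1 : ∀ (C : Set X) (hC : MeasurableSet C), ∀ᵐ x ∂μ, x ∈ C → (S : Equiv.Perm X)⁻¹ x ∈ C := by
    intro C hC
    have h2 := koopman_indicatorL2 S hC
    have h3 : _root_.koopman S (indicatorL2 μ hC) = indicatorL2 μ hC := h _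
    rw [h3] at h2
    filter_upwards [h2, indicatorConstLp_coeFn (p := 2) (hs := hC)
      (hμs := measure_ne_top μ C) (c := (1 : ℂ))] with x hx hx' hxC
    rw [indicatorL2, hx', Set.indicator_of_mem hxC] at hx
    by_contra hn
    rw [Set.indicator_of_notMem hn, mul_zero] at hx
    exact one_ne_zero hx
  have h2 : ∀ᵐ x ∂μ, (S : Equiv.Perm X)⁻¹ x = x := by
    filter_upwards [ae_all_iff.2 fun n => h1 (A n) (hA n),
      ae_all_iff.2 fun n => h1 (A n)ᶜ (hA n).compl] with x hx hx'
    refine hsep _ trivial _ trivial fun n => ⟨fun hn => ?_, hx n⟩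
    by_contra hc
    exact hx' n hc hn
  refine mk_eq_one.2 ?_
  filter_upwards [S.2.1.ae h2] with x hx
  rw [perm_inv_apply] at hx
  exact hx.symm

/-- The orbit map of a sequence in `L²` under the inverses. -/
def invOrbit (f : ℕ → Lp ℂ 2 μ) (S : AutStar μ) (n : ℕ) : Lp ℂ 2 μ := S⁻¹.koopman (f n)

lemma isInducing_invOrbit {f : ℕ → Lp ℂ 2 μ} (hf : DenseRange f) :
    IsInducing (invOrbit f) := by
  have hc : Continuous (invOrbit f) :=
    continuous_pi fun n => (continuous_koopman (f n)).comp continuous_inv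
  refine isInducing_iff_nhds.2 fun S => le_antisymm (hc.tendsto S).le_comap ?_
  have h1 : Tendsto (fun T : AutStar μ => T⁻¹) (comap (invOrbit f) (𝓝 (invOrbit f S)))
      (𝓝 S⁻¹) := by
    refine tendsto_nhds_iff.2 fun g => ?_
    refine hf.induction_on (p := fun g => Tendsto (fun T : AutStar μ => T⁻¹.koopman g)
      (comap (invOrbit f) (𝓝 (invOrbit f S))) (𝓝 (S⁻¹.koopman g))) g
      (isClosed_setOf_tendsto_linearIsometry _ (fun T : AutStar μ => T⁻¹.koopman) _) fun n => ?_
    exact ((continuous_apply n).tendsto (invOrbit f S)).comp tendsto_comap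
  have h2 := (continuous_inv.tendsto S⁻¹).comp h1
  simp only [Function.comp_def, inv_inv] at h2
  exact tendsto_id'.1 h2

lemma injective_invOrbit [MeasurableSpace.CountablySeparated X] {f : ℕ → Lp ℂ 2 μ}
    (hf : DenseRange f) : Function.Injective (invOrbit f) := by
  intro S T h
  have h1 : ∀ g, S⁻¹.koopman g = T⁻¹.koopman g := by
    intro g
    refine congrFun (DenseRange.equalizer hf S⁻¹.koopman.continuous T⁻¹.koopman.continuous ?_) g
    exact h
  have h2 : S * T⁻¹ = 1 := eq_one_of_koopman_eq fun g => by
    rw [koopman_mul, ← h1, koopman_apply_inv]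
  exact mul_inv_eq_one.1 h2

/-- Using the orbits of inverses makes the metric right-invariant: (ac)⁻¹ = c⁻¹a⁻¹, and Φ(c⁻¹) is
isometric in every coordinate. L² is separable, so countably many vectors suffice. -/
lemma exists_isCompatibleRightInvariant [MeasurableSpace.CountablyGenerated X]
    [MeasurableSpace.CountablySeparated X] :
    ∃ d : MetricSpace (AutStar μ), IsCompatibleRightInvariant d := by
  have : Fact ((2 : ℝ≥0∞) ≠ ∞) := ⟨by simp⟩
  obtain ⟨f, hf⟩ := TopologicalSpace.exists_dense_seq (Lp ℂ 2 μ)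
  let _ : MetricSpace (ℕ → Lp ℂ 2 μ) := PiCountable.metricSpace
  refine ⟨MetricSpace.induced (invOrbit f) (injective_invOrbit hf) inferInstance, ?_, ?_⟩
  · exact (isInducing_invOrbit hf).eq_induced.symm
  · intro a b c
    change dist (invOrbit f (a * c)) (invOrbit f (b * c)) = dist (invOrbit f a) (invOrbit f b)
    rw [PiCountable.dist_eq_tsum, PiCountable.dist_eq_tsum]
    refine tsum_congr fun n => ?_
    simp only [invOrbit, mul_inv_rev, koopman_mul, LinearIsometry.dist_map]

end AutStar

end Nhds

/-! ### Comparing two Koopman operators on an indicator -/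

section Near

variable {X : Type*} [MeasurableSpace X] {μ : Measure X}

lemma norm_sq_L2_eq_integral (f : Lp ℂ 2 μ) : ‖f‖ ^ 2 = ∫ x, ‖f x‖ ^ 2 ∂μ := by
  have h1 : (inner ℂ f f : ℂ) = ((‖f‖ ^ 2 : ℝ) : ℂ) := by
    rw [inner_self_eq_norm_sq_to_K]; simp
  have h2 : (inner ℂ f f : ℂ) = ((∫ x, ‖f x‖ ^ 2 ∂μ : ℝ) : ℂ) := by
    rw [L2.inner_def, ← integral_complex_ofReal]
    refine integral_congr_ae (.of_forall fun x => ?_)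
    simp only [inner_self_eq_norm_sq_to_K]
    simp
  exact Complex.ofReal_injective (h1.symm.trans h2)

variable [IsProbabilityMeasure μ]

lemma integral_rnDeriv_map (T : nonsingularGroup μ) :
    ∫ y, ((μ.map (T : Equiv.Perm X)).rnDeriv μ y).toReal ∂μ = 1 := by
  have : IsProbabilityMeasure (μ.map (T : Equiv.Perm X)) :=
    Measure.isProbabilityMeasure_map T.2.1.measurable.aemeasurable
  rw [Measure.integral_toReal_rnDeriv T.2.1.absolutelyContinuous]
  simp

lemma setIntegral_rnDeriv_map (T : nonsingularGroup μ) {B : Set X} (hB : MeasurableSet B) :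
    ∫ y in B, ((μ.map (T : Equiv.Perm X)).rnDeriv μ y).toReal ∂μ =
      μ.real ((T : Equiv.Perm X) ⁻¹' B) := by
  have : IsProbabilityMeasure (μ.map (T : Equiv.Perm X)) :=
    Measure.isProbabilityMeasure_map T.2.1.measurable.aemeasurable
  rw [Measure.setIntegral_toReal_rnDeriv T.2.1.absolutelyContinuous,
    map_measureReal_apply T.2.1.measurable hB]

/-- If `S` and `T` move points into a set `C` from the same side and with comparable densities on
a large set, then their Koopman operators are close on the indicator function of `C`. -/
lemma norm_koopman_indicator_sub_sq_le (S T : nonsingularGroup μ) {C : Set X}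
    (hC : MeasurableSet C) {B : Set X} (hB : MeasurableSet B) {κ : ℝ}
    (h : ∀ᵐ y ∂μ, y ∈ B → ((S : Equiv.Perm X)⁻¹ y ∈ C ↔ (T : Equiv.Perm X)⁻¹ y ∈ C) ∧
      κ ^ 2 * ((μ.map (T : Equiv.Perm X)).rnDeriv μ y).toReal ≤
        ((μ.map (S : Equiv.Perm X)).rnDeriv μ y).toReal) :
    ‖koopman S (indicatorL2 μ hC) - koopman T (indicatorL2 μ hC)‖ ^ 2 ≤
      2 * (1 - κ * μ.real ((T : Equiv.Perm X) ⁻¹' B)) := by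
  -- Expand the square: on B the cross term is at least κ ρT where both indicators are 1, and off B
  -- it is dropped. As ρS and ρT both have integral 1, a one-sided comparison of densities is
  -- enough.
  set ρS : X → ℝ := fun y => ((μ.map (S : Equiv.Perm X)).rnDeriv μ y).toReal with hρS
  set ρT : X → ℝ := fun y => ((μ.map (T : Equiv.Perm X)).rnDeriv μ y).toReal with hρT
  have iS : Integrable ρS μ := Measure.integrable_toReal_rnDeriv
  have iT : Integrable ρT μ := Measure.integrable_toReal_rnDeriv
  have iB : Integrable (B.indicator ρT) μ := iT.indicator hB
  rw [norm_sq_L2_eq_integral]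
  calc ∫ y, ‖(koopman S (indicatorL2 μ hC) - koopman T (indicatorL2 μ hC) : Lp ℂ 2 μ) y‖ ^ 2 ∂μ
      ≤ ∫ y, (ρS y + ρT y - 2 * κ * B.indicator ρT y) ∂μ := by
        refine integral_mono_of_nonneg (.of_forall fun y => by positivity)
          ((iS.add iT).sub (iB.const_mul _)) ?_
        filter_upwards [h, koopman_indicatorL2 S hC, koopman_indicatorL2 T hC,
          Lp.coeFn_sub (koopman S (indicatorL2 μ hC)) (koopman T (indicatorL2 μ hC))]
          with y hy h1 h2 h3
        rw [h3, Pi.sub_apply, h1, h2]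
        change ‖(Real.sqrt (ρS y) : ℂ) * _ - (Real.sqrt (ρT y) : ℂ) * _‖ ^ 2 ≤ _
        have hS0 : 0 ≤ ρS y := ENNReal.toReal_nonneg
        have hT0 : 0 ≤ ρT y := ENNReal.toReal_nonneg
        have e1 := Real.sq_sqrt hS0
        have e2 := Real.sq_sqrt hT0
        have n1 := Real.sqrt_nonneg (ρS y)
        have n2 := Real.sqrt_nonneg (ρT y)
        by_cases hyB : y ∈ B
        · obtain ⟨hiff, hle⟩ := hy hyB
          have hs : κ * Real.sqrt (ρT y) ≤ Real.sqrt (ρS y) := by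
            refine Real.le_sqrt_of_sq_le ?_
            rw [mul_pow, e2]
            exact hle
          have hs2 : κ * ρT y ≤ Real.sqrt (ρS y) * Real.sqrt (ρT y) := by
            calc κ * ρT y = κ * Real.sqrt (ρT y) * Real.sqrt (ρT y) := by
                  rw [mul_assoc, ← sq, e2]
              _ ≤ _ := by gcongr
          rw [Set.indicator_of_mem hyB]
          by_cases hyC : (T : Equiv.Perm X)⁻¹ y ∈ C
          · rw [Set.indicator_of_mem (hiff.2 hyC), Set.indicator_of_mem hyC, mul_one, mul_one,
              ← Complex.ofReal_sub, Complex.norm_real, Real.norm_eq_abs, sq_abs]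
            nlinarith
          · rw [Set.indicator_of_notMem (fun h => hyC (hiff.1 h)), Set.indicator_of_notMem hyC]
            simp only [mul_zero, sub_zero, norm_zero]
            nlinarith [sq_nonneg (Real.sqrt (ρS y) - Real.sqrt (ρT y))]
        · rw [Set.indicator_of_notMem hyB]
          have gen : ∀ (D : Set X) (z : X), D.indicator (fun _ => (1 : ℂ)) z =
              ((D.indicator (fun _ => (1 : ℝ)) z : ℝ) : ℂ) := by
            intro D z
            by_cases hz : z ∈ D <;> simp [hz]
          rw [gen, gen, ← Complex.ofReal_mul, ← Complex.ofReal_mul, ← Complex.ofReal_sub,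
            Complex.norm_real, Real.norm_eq_abs, sq_abs]
          have nn := mul_nonneg n1 n2
          rcases Set.indicator_eq_zero_or_self C (fun _ => (1 : ℝ)) ((S : Equiv.Perm X)⁻¹ y)
            with h | h <;>
          rcases Set.indicator_eq_zero_or_self C (fun _ => (1 : ℝ)) ((T : Equiv.Perm X)⁻¹ y)
            with h' | h' <;> rw [h, h'] <;> nlinarith
    _ = 2 * (1 - κ * μ.real ((T : Equiv.Perm X) ⁻¹' B)) := by
        have iST : Integrable (fun y => ρS y + ρT y) μ := iS.add iT
        rw [integral_sub iST (iB.const_mul _), integral_add iS iT, integral_const_mul,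
          integral_indicator hB, setIntegral_rnDeriv_map T hB, integral_rnDeriv_map,
          integral_rnDeriv_map]
        ring

end Near

/-! ### Concentration of measure in symmetric groups -/

section Concentration

open Finset

/-- The Hamming distance of two permutations. -/
def permDist {J : Type*} [Fintype J] [DecidableEq J] (σ τ : Equiv.Perm J) : ℕ :=
  #{j | σ j ≠ τ j}

lemma permDist_triangle {J : Type*} [Fintype J] [DecidableEq J] (σ τ υ : Equiv.Perm J) :
    permDist σ υ ≤ permDist σ τ + permDist τ υ := by
  unfold permDist
  refine (card_le_card fun j => ?_).trans (card_union_le _ _)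
  simp only [mem_filter, mem_univ, true_and, mem_union]
  intro h
  by_contra! hc
  exact h (hc.1.trans hc.2)

lemma permDist_comm {J : Type*} [Fintype J] [DecidableEq J] (σ τ : Equiv.Perm J) :
    permDist σ τ = permDist τ σ := by
  simp only [permDist, ne_comm]

lemma permDist_decomposeOption_right {α : Type*} [Fintype α] [DecidableEq α] (i : Option α)
    (τ τ' : Equiv.Perm α) :
    permDist (Equiv.Perm.decomposeOption.symm (i, τ)) (Equiv.Perm.decomposeOption.symm (i, τ')) =
      permDist τ τ' := by
  unfold permDist
  refine Eq.trans (congrArg card (Finset.ext fun j => ?_)) (card_map Function.Embedding.some)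
  cases j with
  | none => simp
  | some x => simp

/-- Both permutations are `Equiv.optionCongr τ` followed by the swap of `none` with i or i', and the
two swaps agree away from `none`, i and i'. -/
lemma permDist_decomposeOption_left {α : Type*} [Fintype α] [DecidableEq α] (i i' : Option α)
    (τ : Equiv.Perm α) :
    permDist (Equiv.Perm.decomposeOption.symm (i, τ))
      (Equiv.Perm.decomposeOption.symm (i', τ)) ≤ 3 := by
  unfold permDist
  have key : ∀ (i : Option α) (j : Option α), Equiv.Perm.decomposeOption.symm (i, τ) j =
      Equiv.swap none i (Equiv.optionCongr τ j) := fun _ _ => rfl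
  have hsub : ({j | Equiv.Perm.decomposeOption.symm (i, τ) j ≠
      Equiv.Perm.decomposeOption.symm (i', τ) j} : Finset (Option α)) ⊆
      ({none, i, i'} : Finset (Option α)).image (Equiv.optionCongr τ).symm := by
    intro j hj
    simp only [mem_filter, mem_univ, true_and, key] at hj
    rw [mem_image]
    refine ⟨Equiv.optionCongr τ j, ?_, Equiv.symm_apply_apply _ _⟩
    by_contra hn
    simp only [mem_insert, mem_singleton, not_or] at hn
    rw [Equiv.swap_apply_of_ne_of_ne hn.1 hn.2.1, Equiv.swap_apply_of_ne_of_ne hn.1 hn.2.2] at hj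
    exact hj rfl
  exact (card_le_card hsub).trans (card_image_le.trans card_le_three)

/-- The average of a real function on a finite type. -/
def finAvg {A : Type*} [Fintype A] (f : A → ℝ) : ℝ := (∑ a, f a) / Fintype.card A

lemma card_mul_finAvg {A : Type*} [Fintype A] [Nonempty A] (f : A → ℝ) :
    Fintype.card A * finAvg f = ∑ a, f a := by
  have : (Fintype.card A : ℝ) ≠ 0 := Nat.cast_ne_zero.2 Fintype.card_ne_zero
  rw [finAvg]
  field_simp

lemma finAvg_comp_equiv {A B : Type*} [Fintype A] [Fintype B] (e : A ≃ B) (f : B → ℝ) :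
    finAvg (fun a => f (e a)) = finAvg f := by
  rw [finAvg, finAvg, Fintype.card_congr e, e.sum_comp]

lemma abs_finAvg_sub_le {A : Type*} [Fintype A] [Nonempty A] {f : A → ℝ} {x c : ℝ}
    (h : ∀ a, |x - f a| ≤ c) : |x - finAvg f| ≤ c := by
  have hN : (0 : ℝ) < Fintype.card A := Nat.cast_pos.2 Fintype.card_pos
  have h1 : x - finAvg f = (∑ a, (x - f a)) / Fintype.card A := by
    rw [sum_sub_distrib, ← card_mul_finAvg f]
    simp only [sum_const, card_univ, nsmul_eq_mul]
    field_simp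
  rw [h1, abs_div, abs_of_pos hN, div_le_iff₀ hN]
  calc |∑ a, (x - f a)| ≤ ∑ a, |x - f a| := abs_sum_le_sum_abs _ _
    _ ≤ ∑ _a : A, c := sum_le_sum fun a _ => h a
    _ = c * Fintype.card A := by simp [mul_comm]

lemma abs_finAvg_sub_finAvg_le {A : Type*} [Fintype A] [Nonempty A] {f g : A → ℝ} {c : ℝ}
    (h : ∀ a, |f a - g a| ≤ c) : |finAvg f - finAvg g| ≤ c := by
  have h1 := abs_finAvg_sub_le (x := 0) (f := fun a => g a - f a) (c := c)
    (fun a => by simpa using h a)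
  have h2 : finAvg (fun a => g a - f a) = finAvg g - finAvg f := by
    simp only [finAvg, sum_sub_distrib, sub_div]
  rw [h2] at h1
  simpa using h1

/-- Variance decomposition around the average. -/
lemma sum_sub_sq_eq {A : Type*} [Fintype A] [Nonempty A] (f : A → ℝ) (c : ℝ) :
    ∑ a, (f a - c) ^ 2 = ∑ a, (f a - finAvg f) ^ 2 + Fintype.card A * (finAvg f - c) ^ 2 := by
  have h1 : ∀ a, (f a - c) ^ 2 = (f a - finAvg f) ^ 2 +
      2 * (finAvg f - c) * (f a - finAvg f) + (finAvg f - c) ^ 2 := fun a => by ring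
  simp only [h1, sum_add_distrib, ← mul_sum, sum_sub_distrib, ← card_mul_finAvg f]
  simp

/-- Efron–Stein type variance bound on the symmetric group. -/
theorem sum_perm_sub_finAvg_sq_le (J : Type*) [Fintype J] [DecidableEq J] {b : ℝ} (hb : 0 ≤ b)
    (f : Equiv.Perm J → ℝ) (hf : ∀ σ τ, |f σ - f τ| ≤ b * permDist σ τ) :
    ∑ σ, (f σ - finAvg f) ^ 2 ≤
      9 * b ^ 2 * Fintype.card J * Fintype.card (Equiv.Perm J) := by
  classical
  suffices H : ∀ (inst : DecidableEq J) (f : Equiv.Perm J → ℝ),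
      (∀ σ τ, |f σ - f τ| ≤ b * permDist σ τ) → ∑ σ, (f σ - finAvg f) ^ 2 ≤
        9 * b ^ 2 * Fintype.card J * Fintype.card (Equiv.Perm J) from H _ f hf
  clear hf f
  refine Fintype.induction_empty_option (P := fun J [Fintype J] => ∀ (inst : DecidableEq J)
    (f : Equiv.Perm J → ℝ), (∀ σ τ, |f σ - f τ| ≤ b * permDist σ τ) →
      ∑ σ, (f σ - finAvg f) ^ 2 ≤ 9 * b ^ 2 * Fintype.card J * Fintype.card (Equiv.Perm J))
    ?_ ?_ ?_ J
  · intro α β _ e ih inst f hf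
    let _ : Fintype α := Fintype.ofEquiv β e.symm
    let _ : DecidableEq α := e.decidableEq
    have h1 := ih inferInstance (fun σ => f (e.permCongr σ)) ?_
    · rw [finAvg_comp_equiv (Equiv.permCongr e) f,
        (Equiv.permCongr e).sum_comp (fun σ => (f σ - finAvg f) ^ 2),
        Fintype.card_congr (Equiv.permCongr e)] at h1
      rw [← Fintype.card_congr e]
      convert h1
    · intro σ τ
      refine (hf _ _).trans_eq ?_
      congr 2
      unfold permDist
      rw [← card_map e.symm.toEmbedding]
      congr 1
      ext j
      simp [mem_map_equiv]
  · intro inst f hf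
    have : ∀ σ, f σ = finAvg f := fun σ => by
      rw [finAvg]
      simp [Subsingleton.elim _ σ]
    rw [sum_eq_zero fun σ _ => by rw [this σ, sub_self, sq, zero_mul]]
    positivity
  · intro α _ ih inst f hf
    let _ : DecidableEq α := Classical.decEq α
    obtain rfl : inst = Option.instDecidableEq := Subsingleton.elim _ _
    -- Law of total variance over the classes of permutations with a given image i of `none`. Inside
    -- a class the induction hypothesis applies; the class averages differ by at most 3b, which adds
    -- 9b² for the new point.
    set D := (Equiv.Perm.decomposeOption (α := α)).symm
    set g : Option α → Equiv.Perm α → ℝ := fun i τ => f (D (i, τ)) with hg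
    set N : ℝ := (Fintype.card (Equiv.Perm α) : ℝ) with hN
    have e1 : ∑ σ, (f σ - finAvg f) ^ 2 = ∑ i, ∑ τ, (g i τ - finAvg f) ^ 2 := by
      rw [← D.sum_comp, Fintype.sum_prod_type]
    have e2 : finAvg f = finAvg fun i => finAvg (g i) := by
      rw [← finAvg_comp_equiv D f, finAvg, Fintype.sum_prod_type, Fintype.card_prod, finAvg]
      simp only [finAvg]
      rw [← sum_div, div_div, mul_comm]
      push_cast
      simp only [hg]
    have h1 : ∀ i, ∑ τ, (g i τ - finAvg (g i)) ^ 2 ≤ 9 * b ^ 2 * Fintype.card α * N := by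
      intro i
      refine ih _ (g i) fun σ τ => ?_
      rw [← permDist_decomposeOption_right i]
      exact hf _ _
    have h2 : ∀ i, (finAvg (g i) - finAvg f) ^ 2 ≤ 9 * b ^ 2 := by
      intro i
      have : |finAvg (g i) - finAvg f| ≤ b * 3 := by
        rw [e2]
        refine abs_finAvg_sub_le fun i' => abs_finAvg_sub_finAvg_le fun τ => ?_
        refine (hf _ _).trans ?_
        gcongr
        exact_mod_cast permDist_decomposeOption_left i i' τ
      calc _ = |finAvg (g i) - finAvg f| ^ 2 := (sq_abs _).symm
        _ ≤ (b * 3) ^ 2 := by gcongr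
        _ = _ := by ring
    calc ∑ σ, (f σ - finAvg f) ^ 2 = ∑ i, ∑ τ, (g i τ - finAvg f) ^ 2 := e1
      _ = ∑ i, (∑ τ, (g i τ - finAvg (g i)) ^ 2 + N * (finAvg (g i) - finAvg f) ^ 2) :=
          sum_congr rfl fun i _ => sum_sub_sq_eq _ _
      _ ≤ ∑ _i : Option α, (9 * b ^ 2 * Fintype.card α * N + N * (9 * b ^ 2)) := by
          gcongr with i
          · exact h1 i
          · exact h2 i
      _ = _ := by
          rw [Fintype.card_congr D.symm, Fintype.card_prod]
          simp only [sum_const, card_univ, nsmul_eq_mul, Fintype.card_option]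
          push_cast
          ring

/-- Concentration of measure in symmetric groups with the Hamming distance. -/
theorem card_near_le (J : Type*) [Fintype J] [DecidableEq J] {b t c δ : ℝ} (hb : 0 ≤ b)
    (ht : 0 < t) (hc : 0 < c)
    (h1 : 36 * (b ^ 2 * Fintype.card J) ≤ c * t ^ 2)
    (h2 : 36 * (b ^ 2 * Fintype.card J) ≤ δ * t ^ 2) (A : Finset (Equiv.Perm J))
    (hA : c * Fintype.card (Equiv.Perm J) ≤ #A) :
    (#{σ | ∀ a ∈ A, t ≤ b * permDist σ a} : ℝ) ≤ δ * Fintype.card (Equiv.Perm J) := by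
  have hN : (0 : ℝ) < Fintype.card (Equiv.Perm J) := Nat.cast_pos.2 Fintype.card_pos
  set N : ℝ := (Fintype.card (Equiv.Perm J) : ℝ)
  have hAne : A.Nonempty := by
    rw [← card_pos, ← Nat.cast_pos (α := ℝ)]
    exact lt_of_lt_of_le (by positivity) hA
  -- b times the Hamming distance to A: it is b-Lipschitz and vanishes on A.
  set f : Equiv.Perm J → ℝ := fun σ => A.inf' hAne fun a => b * permDist σ a with hf
  have hlip : ∀ σ τ, f σ ≤ f τ + b * permDist σ τ := by
    intro σ τ
    obtain ⟨a, ha, hfa⟩ := exists_mem_eq_inf' hAne fun a => b * (permDist τ a : ℝ)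
    calc f σ ≤ b * permDist σ a := inf'_le _ ha
      _ ≤ b * (permDist σ τ + permDist τ a) := by
          gcongr
          exact_mod_cast permDist_triangle σ τ a
      _ = f τ + b * permDist σ τ := by
          rw [hf]
          simp only [hfa]
          ring
  have hvar := sum_perm_sub_finAvg_sq_le J hb f fun σ τ => by
    rw [abs_sub_le_iff]
    have := hlip σ τ
    have h' := hlip τ σ
    rw [permDist_comm] at h'
    constructor <;> linarith
  set m := finAvg f with hm
  set V : ℝ := 9 * b ^ 2 * Fintype.card J with hV
  have hfA : ∀ a ∈ A, f a ≤ 0 := fun a ha => by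
    refine (inf'_le _ ha).trans ?_
    simp [permDist]
  have hf0 : ∀ σ, 0 ≤ f σ := fun σ => by
    refine le_inf' _ _ fun a _ => ?_
    positivity
  have hm0 : 0 ≤ m := div_nonneg (sum_nonneg fun σ _ => hf0 σ) hN.le
  -- On A, of proportion at least c, the deviation of f from its mean is m, so the variance bound
  -- limits m.
  have hm2 : m ^ 2 * (c * N) ≤ V * N := by
    calc m ^ 2 * (c * N) ≤ m ^ 2 * #A := by gcongr
      _ = ∑ _a ∈ A, m ^ 2 := by simp [mul_comm]
      _ = ∑ a ∈ A, (f a - m) ^ 2 := sum_congr rfl fun a ha => by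
          rw [le_antisymm (hfA a ha) (hf0 a)]; ring
      _ ≤ ∑ a, (f a - m) ^ 2 :=
          sum_le_sum_of_subset_of_nonneg (subset_univ _) fun _ _ _ => sq_nonneg _
      _ ≤ V * N := hvar
  have hmt : m ≤ t / 2 := by
    have h3 : m ^ 2 * c ≤ V := le_of_mul_le_mul_right (by linarith) hN
    have h4 : m ^ 2 * c ≤ (t / 2) ^ 2 * c := by
      calc _ ≤ V := h3
        _ ≤ _ := by rw [hV]; linarith
    exact le_of_sq_le_sq (by exact le_of_mul_le_mul_right h4 hc) (by positivity)
  set E : Finset (Equiv.Perm J) := {σ | ∀ a ∈ A, t ≤ b * permDist σ a} with hE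
  -- Chebyshev: f ≥ t on E and m ≤ t/2. The constant 36 is 9 from the variance times 4 from (t/2)².
  have hE2 : (#E : ℝ) * (t / 2) ^ 2 ≤ V * N := by
    calc (#E : ℝ) * (t / 2) ^ 2 = ∑ _σ ∈ E, (t / 2) ^ 2 := by simp
      _ ≤ ∑ σ ∈ E, (f σ - m) ^ 2 := by
          refine sum_le_sum fun σ hσ => ?_
          have : t ≤ f σ := le_inf' _ _ fun a ha => (mem_filter.1 hσ).2 a ha
          have h5 : t / 2 ≤ f σ - m := by linarith
          gcongr
      _ ≤ ∑ a, (f a - m) ^ 2 :=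
          sum_le_sum_of_subset_of_nonneg (subset_univ _) fun _ _ _ => sq_nonneg _
      _ ≤ V * N := hvar
  have h6 : (#E : ℝ) * (t / 2) ^ 2 ≤ δ * N * (t / 2) ^ 2 := by
    refine hE2.trans ?_
    have : V ≤ δ * (t / 2) ^ 2 := by rw [hV]; linarith
    calc V * N ≤ δ * (t / 2) ^ 2 * N := by gcongr
      _ = _ := by ring
  exact le_of_mul_le_mul_right h6 (by positivity)

end Concentration

/-! ### Isomorphism of non-atomic standard Borel probability spaces -/

section Isomorphism

/-- Identify X with the plane: its vertical lines are disjoint, so only countably many have positive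
mass. The null set found this way leaves room for completing an almost everywhere defined
isomorphism to a bijection. -/
lemma exists_measurableSet_null_not_countable {X : Type*} [MeasurableSpace X]
    [StandardBorelSpace X] (μ : Measure X) [IsProbabilityMeasure μ] [NullSingletonClass μ] :
    ∃ N : Set X, MeasurableSet N ∧ μ N = 0 ∧ ¬ N.Countable := by
  have hX : ¬ Countable X := fun h => by
    have h1 : μ Set.univ = 0 := Set.Countable.measure_zero Set.countable_univ μ
    simp at h1
  have hR : ¬ Countable (ℝ × ℝ) := fun h => by
    have : Countable ℝ := Function.Injective.countable (f := fun x : ℝ => (x, (0 : ℝ)))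
      fun x y h => congrArg Prod.fst h
    exact Cardinal.not_countable_real (Set.countable_univ (α := ℝ))
  let e : X ≃ᵐ ℝ × ℝ := PolishSpace.measurableEquivOfNotCountable hX hR
  let A : ℝ → Set X := fun a => e ⁻¹' (({a} : Set ℝ) ×ˢ Set.univ)
  have hA : ∀ a, MeasurableSet (A a) := fun a =>
    e.measurable ((measurableSet_singleton a).prod MeasurableSet.univ)
  have hd : Pairwise (Function.onFun Disjoint A) := by
    intro a b hab
    refine Set.disjoint_left.2 fun x hx hx' => hab ?_
    have h1 : (e x).1 = a := hx.1
    have h2 : (e x).1 = b := hx'.1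
    exact h1.symm.trans h2
  have hc := Measure.countable_meas_pos_of_disjoint_iUnion (μ := μ) hA hd
  have : ∃ a, ¬ 0 < μ (A a) := by
    by_contra! h
    refine Cardinal.not_countable_real (hc.mono fun a _ => h a)
  obtain ⟨a, ha⟩ := this
  refine ⟨A a, hA a, by simpa using ha, fun hcount => ?_⟩
  have h1 : ((fun b : ℝ => e.symm (a, b)) '' Set.univ).Countable := by
    refine hcount.mono ?_
    rintro _ ⟨b, _, rfl⟩
    simp [A]
  have h2 : Function.Injective fun b : ℝ => e.symm (a, b) := fun b c h => by
    simpa using h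
  exact Cardinal.not_countable_real (Set.countable_of_injective_of_countable_image h2.injOn h1)

/-- A measure preserving map between non-atomic standard Borel probability spaces which is
essentially injective agrees almost everywhere with a Borel isomorphism. -/
theorem exists_measurableEquiv_ae_eq {X Y : Type*} [MeasurableSpace X] [StandardBorelSpace X]
    [MeasurableSpace Y] [StandardBorelSpace Y] {μ : Measure X} {ν : Measure Y}
    [IsProbabilityMeasure μ] [IsProbabilityMeasure ν] [NullSingletonClass μ] [NullSingletonClass ν]
    {f : X → Y} (hf : MeasurePreserving f μ ν) {D : Set X} (hD : MeasurableSet D)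
    (hD0 : μ Dᶜ = 0) (hinj : Set.InjOn f D) : ∃ e : X ≃ᵐ Y, ∀ᵐ x ∂μ, e x = f x := by
  obtain ⟨N, hN, hN0, hNc⟩ := exists_measurableSet_null_not_countable μ
  obtain ⟨N', hN', hN'0, hN'c⟩ := exists_measurableSet_null_not_countable ν
  -- Removing N and the preimage of N' keeps the complements of A and of f(A) uncountable, hence
  -- Borel isomorphic; on A, f is an injective Borel map and so a measurable embedding.
  set A : Set X := (D \ N) \ f ⁻¹' N' with hA
  have hAm : MeasurableSet A := (hD.diff hN).diff (hf.measurable hN')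
  have hA0 : μ Aᶜ = 0 := by
    have : Aᶜ ⊆ Dᶜ ∪ N ∪ f ⁻¹' N' := by
      intro x hx
      by_contra hn
      simp only [Set.mem_union, not_or, Set.mem_compl_iff, not_not] at hn
      exact hx ⟨⟨hn.1.1, hn.1.2⟩, hn.2⟩
    refine measure_mono_null this (measure_union_null (measure_union_null hD0 hN0) ?_)
    rw [hf.measure_preimage hN'.nullMeasurableSet, hN'0]
  have : StandardBorelSpace A := hAm.standardBorel
  have hemb : MeasurableEmbedding (A.domRestrict f) := by
    refine Measurable.measurableEmbedding (hf.measurable.comp measurable_subtype_coe) ?_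
    exact Set.injOn_iff_injective.1 (hinj.mono fun x hx => hx.1.1)
  set B : Set Y := Set.range (A.domRestrict f) with hB
  have hBm : MeasurableSet B := hemb.measurableSet_range
  have : StandardBorelSpace (Aᶜ : Set X) := hAm.compl.standardBorel
  have : StandardBorelSpace (Bᶜ : Set Y) := hBm.compl.standardBorel
  have hAc : ¬ Countable (Aᶜ : Set X) := fun h => hNc <|
    Set.Countable.mono (by intro x hx hxA; exact hxA.1.2 hx) (Set.countable_coe_iff.1 h)
  have hBc : ¬ Countable (Bᶜ : Set Y) := fun h => hN'c <| by
    refine (Set.countable_coe_iff.1 h).mono ?_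
    rintro _ hx ⟨⟨x, hxA⟩, rfl⟩
    exact hxA.2 hx
  let e1 : A ≃ᵐ B := hemb.equivRange
  let e2 : (Aᶜ : Set X) ≃ᵐ (Bᶜ : Set Y) := PolishSpace.measurableEquivOfNotCountable hAc hBc
  classical
  refine ⟨(MeasurableEquiv.sumCompl hAm).symm.trans
    ((MeasurableEquiv.sumCongr e1 e2).trans (MeasurableEquiv.sumCompl hBm)), ?_⟩
  have hAe : ∀ᵐ x ∂μ, x ∈ A := by
    rw [ae_iff]; exact hA0
  filter_upwards [hAe] with x hx
  have h1 : (MeasurableEquiv.sumCompl hAm).symm x = Sum.inl ⟨x, hx⟩ := by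
    rw [MeasurableEquiv.symm_apply_eq]
    rfl
  have h2 : e1.sumCongr e2 (Sum.inl ⟨x, hx⟩) = Sum.inl (e1 ⟨x, hx⟩) := rfl
  have h3 : ∀ b : B, MeasurableEquiv.sumCompl hBm (Sum.inl b) = b := fun _ => rfl
  have h4 : (e1 ⟨x, hx⟩ : Y) = f x := congrArg Subtype.val (hemb.equivRange_apply ⟨x, hx⟩)
  rw [MeasurableEquiv.trans_apply, h1, MeasurableEquiv.trans_apply, h2, h3, h4]

/-- Lebesgue measure on the open unit interval, as a measure on the real line. -/
def unitMeasure : Measure ℝ := volume.restrict (Set.Ioo 0 1)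

instance : IsProbabilityMeasure unitMeasure := ⟨by simp [unitMeasure]⟩

instance : NullSingletonClass unitMeasure := by unfold unitMeasure; infer_instance

/-- The quantile function of a measure on the real line. -/
def quantile (μ : Measure ℝ) (t : ℝ) : ℝ :=
  open Classical in if t ∈ Set.Ioo (0 : ℝ) 1 then sInf {x | t ≤ ProbabilityTheory.cdf μ x} else 0

/-- Right continuity of the distribution function makes the infimum defining the quantile attained.
-/
lemma quantile_le_iff (μ : Measure ℝ) {t x : ℝ} (ht : t ∈ Set.Ioo (0 : ℝ) 1) :
    quantile μ t ≤ x ↔ t ≤ ProbabilityTheory.cdf μ x := by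
  set F := ProbabilityTheory.cdf μ
  have hbdd : BddBelow {x | t ≤ F x} := by
    obtain ⟨y, hy⟩ := ((ProbabilityTheory.tendsto_cdf_atBot μ).eventually_lt_const ht.1).exists
    refine ⟨y, fun z hz => ?_⟩
    by_contra! hc
    exact absurd (hz.trans (F.mono hc.le)) (not_le.2 hy)
  have hne : {x | t ≤ F x}.Nonempty := by
    obtain ⟨y, hy⟩ := ((ProbabilityTheory.tendsto_cdf_atTop μ).eventually_const_lt ht.2).exists
    exact ⟨y, hy.le⟩
  rw [quantile, if_pos ht]
  constructor
  · intro h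
    have h1 : ∀ y, x < y → t ≤ F y := fun y hy => by
      obtain ⟨z, hz, hzy⟩ := exists_lt_of_csInf_lt hne (h.trans_lt hy)
      exact hz.trans (F.mono hzy.le)
    have h2 : Tendsto F (𝓝[>] x) (𝓝 (F x)) :=
      ((F.right_continuous x).mono Set.Ioi_subset_Ici_self)
    exact ge_of_tendsto h2 (eventually_nhdsWithin_of_forall h1)
  · exact fun h => csInf_le hbdd h

lemma measurable_quantile (μ : Measure ℝ) : Measurable (quantile μ) := by
  refine measurable_of_Iic fun x => ?_
  have : quantile μ ⁻¹' Set.Iic x = (Set.Ioo 0 1 ∩ Set.Iic (ProbabilityTheory.cdf μ x)) ∪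
      ((Set.Ioo 0 1)ᶜ ∩ {_t | (0 : ℝ) ≤ x}) := by
    ext t
    by_cases ht : t ∈ Set.Ioo (0 : ℝ) 1
    · simp only [Set.mem_preimage, Set.mem_Iic, quantile_le_iff μ ht, Set.mem_union,
        Set.mem_inter_iff, ht, true_and, Set.mem_compl_iff, not_true, false_and, or_false]
    · simp [quantile, ht]
  rw [this]
  exact (measurableSet_Ioo.inter measurableSet_Iic).union
    (measurableSet_Ioo.compl.inter (MeasurableSet.const _))

lemma measurePreserving_quantile (μ : Measure ℝ) [IsProbabilityMeasure μ] :
    MeasurePreserving (quantile μ) unitMeasure μ := by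
  refine ⟨measurable_quantile μ, ?_⟩
  have : IsProbabilityMeasure (unitMeasure.map (quantile μ)) :=
    Measure.isProbabilityMeasure_map (measurable_quantile μ).aemeasurable
  refine Measure.ext_of_Iic _ _ fun x => ?_
  rw [Measure.map_apply (measurable_quantile μ) measurableSet_Iic, unitMeasure,
    Measure.restrict_apply (measurable_quantile μ measurableSet_Iic),
    ← ProbabilityTheory.ofReal_cdf μ x]
  have h1 : quantile μ ⁻¹' Set.Iic x ∩ Set.Ioo 0 1 =
      Set.Iic (ProbabilityTheory.cdf μ x) ∩ Set.Ioo 0 1 := by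
    ext t
    simp only [Set.mem_inter_iff, and_congr_left_iff, Set.mem_preimage, Set.mem_Iic]
    exact fun ht => quantile_le_iff μ ht
  rw [h1]
  have h0 := ProbabilityTheory.cdf_nonneg μ x
  have h2 := ProbabilityTheory.cdf_le_one μ x
  have h3 : (Set.Iic (ProbabilityTheory.cdf μ x) ∩ Set.Ioo 0 1 : Set ℝ) =ᵐ[volume]
      (Set.Iic (ProbabilityTheory.cdf μ x) ∩ Set.Ioc 0 1 : Set ℝ) :=
    ae_eq_set_inter (ae_eq_refl _) Ioo_ae_eq_Ioc
  rw [measure_congr h3, Set.inter_comm, Set.Ioc_inter_Iic, Real.volume_Ioc, min_eq_right h2,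
    sub_zero]

/-- Equal quantiles at s < t would make the quantile function constant on (s, t), so its value would
be an atom. -/
lemma injOn_quantile (μ : Measure ℝ) [IsProbabilityMeasure μ] [NullSingletonClass μ] :
    Set.InjOn (quantile μ) (Set.Ioo 0 1) := by
  have key : ∀ s t : ℝ, s ∈ Set.Ioo (0 : ℝ) 1 → t ∈ Set.Ioo (0 : ℝ) 1 → s < t →
      quantile μ s ≠ quantile μ t := by
    intro s t hs ht hst h
    have h1 : Set.Ioo s t ⊆ quantile μ ⁻¹' {quantile μ s} ∩ Set.Ioo 0 1 := by
      intro r hr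
      have hr' : r ∈ Set.Ioo (0 : ℝ) 1 := ⟨hs.1.trans hr.1, hr.2.trans ht.2⟩
      refine ⟨le_antisymm ?_ ?_, hr'⟩
      · rw [h]
        exact (quantile_le_iff μ hr').2 (hr.2.le.trans ((quantile_le_iff μ ht).1 le_rfl))
      · exact (quantile_le_iff μ hs).2 (hr.1.le.trans ((quantile_le_iff μ hr').1 le_rfl))
    have h2 : unitMeasure (quantile μ ⁻¹' {quantile μ s}) = 0 := by
      rw [(measurePreserving_quantile μ).measure_preimage
        (measurableSet_singleton _).nullMeasurableSet, measure_singleton]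
    rw [unitMeasure, Measure.restrict_apply
      (measurable_quantile μ (measurableSet_singleton _))] at h2
    have h3 := measure_mono_null h1 h2
    rw [Real.volume_Ioo, ENNReal.ofReal_eq_zero] at h3
    linarith
  intro s hs t ht h
  rcases lt_trichotomy s t with h1 | h1 | h1
  · exact absurd h (key s t hs ht h1)
  · exact h1
  · exact absurd h.symm (key t s ht hs h1)

/-- A non-atomic standard Borel probability space is isomorphic to the unit interval, in such a way
that a given function into `ℕ` becomes essentially monotone. -/
theorem exists_measurableEquiv_unitMeasure {X : Type*} [MeasurableSpace X] [StandardBorelSpace X]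
    (μ : Measure X) [IsProbabilityMeasure μ] [NullSingletonClass μ] {q : X → ℕ}
    (hq : Measurable q) :
    ∃ e : ℝ ≃ᵐ X, MeasurePreserving e unitMeasure μ ∧
      ∀ᵐ t ∂unitMeasure, ∀ n : ℕ, q (e t) < n ↔ t ≤ μ.real {x | q x < n} := by
  have hX : Nonempty X := by
    by_contra h
    rw [not_nonempty_iff] at h
    have h1 : μ Set.univ = 0 := by rw [Set.univ_eq_empty_iff.2 h, measure_empty]
    simp at h1
  let j : X → unitInterval := unitInterval.sigmoid ∘ embeddingReal X
  have hj : MeasurableEmbedding j := measurableEmbedding_sigmoid_comp_embeddingReal X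
  have hj01 : ∀ x, (0 : ℝ) < j x ∧ (j x : ℝ) < 1 := fun x => by
    have : j x ∈ Set.Ioo (0 : unitInterval) 1 := by
      rw [← unitInterval.range_sigmoid]
      exact ⟨_, rfl⟩
    exact ⟨by exact_mod_cast this.1, by exact_mod_cast this.2⟩
  -- Since j takes values strictly between 0 and 1, ι is injective and turns {q < n} into {ι ≤ n}.
  -- The monotone quantile function of the law of ι then lays the fibres of q out as successive
  -- intervals.
  let ι : X → ℝ := fun x => q x + j x
  have hlt : ∀ x (n : ℕ), ι x ≤ n ↔ q x < n := by
    intro x n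
    constructor
    · intro h
      have : (q x : ℝ) < n := by linarith [(hj01 x).1]
      exact_mod_cast this
    · intro h
      have : (q x : ℝ) + 1 ≤ n := by exact_mod_cast h
      linarith [(hj01 x).2]
  have hιm : Measurable ι := by
    have h1 : Measurable fun x => (q x : ℝ) := (measurable_of_countable _).comp hq
    exact h1.add (measurable_subtype_coe.comp hj.measurable)
  have hιi : Function.Injective ι := by
    intro x y hxy
    have h1 : q x = q y := by
      refine le_antisymm (Nat.lt_succ_iff.1 ?_) (Nat.lt_succ_iff.1 ?_)
      · rw [← hlt, hxy, hlt]; exact Nat.lt_succ_self _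
      · rw [← hlt, ← hxy, hlt]; exact Nat.lt_succ_self _
    have h2 : (q x : ℝ) + j x = q y + j y := hxy
    rw [h1] at h2
    exact hj.injective (Subtype.ext (by linarith))
  have hι : MeasurableEmbedding ι := hιm.measurableEmbedding hιi
  let μ' : Measure ℝ := μ.map ι
  have : IsProbabilityMeasure μ' := Measure.isProbabilityMeasure_map hιm.aemeasurable
  have : NullSingletonClass μ' := ⟨fun y => by
    rw [Measure.map_apply hιm (measurableSet_singleton y)]
    exact Set.Subsingleton.measure_zero
      (fun a ha b hb => hιi ((show ι a = y from ha).trans (show ι b = y from hb).symm)) μ⟩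
  have hinv : MeasurePreserving hι.invFun μ' μ := by
    refine ⟨hι.measurable_invFun, ?_⟩
    rw [Measure.map_map hι.measurable_invFun hιm, hι.leftInverse_invFun.id, Measure.map_id]
  have hQ := measurePreserving_quantile μ'
  set D : Set ℝ := Set.Ioo 0 1 ∩ quantile μ' ⁻¹' Set.range ι with hD
  have hDm : MeasurableSet D := measurableSet_Ioo.inter (hQ.measurable hι.measurableSet_range)
  have hright : ∀ t ∈ D, ι (hι.invFun (quantile μ' t)) = quantile μ' t := by
    rintro t ⟨_, x, hx⟩
    rw [← hx, hι.leftInverse_invFun x]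
  have hDae : ∀ᵐ t ∂unitMeasure, t ∈ D := by
    have h1 : ∀ᵐ t ∂unitMeasure, t ∈ Set.Ioo (0 : ℝ) 1 := ae_restrict_mem measurableSet_Ioo
    have h2 : ∀ᵐ y ∂μ', y ∈ Set.range ι :=
      (ae_map_iff hιm.aemeasurable hι.measurableSet_range).2 (.of_forall fun x => ⟨x, rfl⟩)
    filter_upwards [h1, hQ.quasiMeasurePreserving.ae h2] with t ht ht'
    exact ⟨ht, ht'⟩
  obtain ⟨e, he⟩ := exists_measurableEquiv_ae_eq (hinv.comp hQ) hDm (ae_iff.1 hDae) (by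
    intro s hs t ht h
    have h1 := congrArg ι h
    simp only [Function.comp_apply] at h1
    rw [hright s hs, hright t ht] at h1
    exact injOn_quantile μ' hs.1 ht.1 h1)
  refine ⟨e, ⟨e.measurable, ?_⟩, ?_⟩
  · rw [Measure.map_congr he, (hinv.comp hQ).map_eq]
  · filter_upwards [he, hDae] with t ht htD n
    rw [ht, Function.comp_apply, ← hlt, hright t htD, quantile_le_iff μ' htD.1,
      ProbabilityTheory.cdf_eq_real, map_measureReal_apply hιm measurableSet_Iic]
    have : ι ⁻¹' Set.Iic (n : ℝ) = {x | q x < n} := by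
      ext x; exact hlt x n
    rw [this]

/-- Two non-atomic standard Borel probability spaces are isomorphic; moreover the isomorphism can be
chosen to respect finite partitions with the same masses. -/
theorem exists_measurableEquiv_of_measureReal_eq {X Y I : Type*} [MeasurableSpace X]
    [StandardBorelSpace X] [MeasurableSpace Y] [StandardBorelSpace Y] [Fintype I]
    [MeasurableSpace I] [MeasurableSingletonClass I] (μ : Measure X) (ν : Measure Y)
    [IsProbabilityMeasure μ] [IsProbabilityMeasure ν] [NullSingletonClass μ] [NullSingletonClass ν]
    {q : X → I} {q' : Y → I} (hq : Measurable q) (hq' : Measurable q')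
    (h : ∀ i, μ.real (q ⁻¹' {i}) = ν.real (q' ⁻¹' {i})) :
    ∃ e : X ≃ᵐ Y, MeasurePreserving e μ ν ∧ ∀ᵐ x ∂μ, q' (e x) = q x := by
  let c : I → ℕ := fun i => Fintype.equivFin I i
  have hc : Function.Injective c := Fin.val_injective.comp (Fintype.equivFin I).injective
  have hcm : Measurable c := measurable_of_countable c
  have hmap : ∀ s : Set I, μ.real (q ⁻¹' s) = ν.real (q' ⁻¹' s) := by
    intro s
    have h1 : μ.map q = ν.map q' := by
      refine Measure.ext_of_singleton fun i => ?_
      rw [Measure.map_apply hq (measurableSet_singleton i),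
        Measure.map_apply hq' (measurableSet_singleton i)]
      exact (measureReal_eq_measureReal_iff (measure_ne_top _ _) (measure_ne_top _ _)).1 (h i)
    have hs : MeasurableSet s := s.toFinite.measurableSet
    rw [← map_measureReal_apply hq hs, h1, map_measureReal_apply hq' hs]
  -- Both spaces are laid out on (0, 1) with corresponding classes over the same intervals, so
  -- passing through (0, 1) matches the classes.
  obtain ⟨e, he, heq⟩ := exists_measurableEquiv_unitMeasure μ (hcm.comp hq)
  obtain ⟨e', he', heq'⟩ := exists_measurableEquiv_unitMeasure ν (hcm.comp hq')
  have hs : MeasurePreserving e.symm μ unitMeasure := he.symm e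
  refine ⟨e.symm.trans e', he'.comp hs, ?_⟩
  filter_upwards [hs.quasiMeasurePreserving.ae heq, hs.quasiMeasurePreserving.ae heq'] with x h1 h2
  have key : ∀ n : ℕ, c (q' (e' (e.symm x))) < n ↔ c (q x) < n := by
    intro n
    have h3 := h1 n
    have h4 := h2 n
    rw [MeasurableEquiv.apply_symm_apply] at h3
    refine h4.trans (Iff.trans ?_ h3.symm)
    have := hmap {i | c i < n}
    exact (by rw [show ν.real {y | (c ∘ q') y < n} = μ.real {x | (c ∘ q) x < n} from this.symm])
  refine hc (le_antisymm ?_ ?_)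
  · exact Nat.lt_succ_iff.1 ((key _).2 (Nat.lt_succ_self _))
  · exact Nat.lt_succ_iff.1 ((key _).1 (Nat.lt_succ_self _))

end Isomorphism

/-! ### Symmetric groups permuting pieces of the space -/

section PermAction

variable {J : Type*} [MeasurableSpace J]

variable {X : Type*} [MeasurableSpace X]

/-- The action of the symmetric group of `J` on `X` through the first coordinate of an
identification of `X` with a product. -/
def permAction (e : X ≃ᵐ J × ℝ) : Equiv.Perm J →* Equiv.Perm X where
  toFun σ := (e.toEquiv.trans (σ.prodCongr (Equiv.refl ℝ))).trans e.toEquiv.symm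
  map_one' := by ext x; simp
  map_mul' σ τ := by ext x; simp; rfl

lemma permAction_apply (e : X ≃ᵐ J × ℝ) (σ : Equiv.Perm J) (x : X) :
    permAction e σ x = e.symm (σ (e x).1, (e x).2) := rfl

lemma fst_permAction (e : X ≃ᵐ J × ℝ) (σ : Equiv.Perm J) (x : X) :
    (e (permAction e σ x)).1 = σ (e x).1 := by
  rw [permAction_apply, MeasurableEquiv.apply_symm_apply]

lemma permAction_eq_self (e : X ≃ᵐ J × ℝ) {σ : Equiv.Perm J} {x : X}
    (h : σ (e x).1 = (e x).1) : permAction e σ x = x := by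
  rw [permAction_apply, h]
  exact e.symm_apply_apply x

variable [Fintype J] [MeasurableSingletonClass J]

/-- The measure on a finite type with given point masses. -/
def weightMeasure (m : J → ℝ) : Measure J := ∑ j, ENNReal.ofReal (m j) • Measure.dirac j

lemma weightMeasure_singleton (m : J → ℝ) (j : J) :
    weightMeasure m {j} = ENNReal.ofReal (m j) := by
  classical
  rw [weightMeasure, Measure.finsetSum_apply, Finset.sum_eq_single j]
  · simp
  · intro i _ hij
    simp [hij]
  · simp

lemma weightMeasure_apply (m : J → ℝ) (hm : ∀ j, 0 ≤ m j) (s : Finset J) :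
    weightMeasure m s = ENNReal.ofReal (∑ j ∈ s, m j) := by
  rw [ENNReal.ofReal_sum_of_nonneg fun j _ => hm j, ← sum_measure_singleton]
  simp only [weightMeasure_singleton]

lemma isProbabilityMeasure_weightMeasure {m : J → ℝ} (hm : ∀ j, 0 ≤ m j) (h1 : ∑ j, m j = 1) :
    IsProbabilityMeasure (weightMeasure m) :=
  ⟨by rw [← Finset.coe_univ, weightMeasure_apply m hm, h1, ENNReal.ofReal_one]⟩

lemma map_weightMeasure {m : J → ℝ} (hm : ∀ j, 0 < m j) (σ : Equiv.Perm J) :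
    (weightMeasure m).map σ =
      (weightMeasure m).withDensity fun j => ENNReal.ofReal (m (σ⁻¹ j) / m j) := by
  refine Measure.ext_of_singleton fun j => ?_
  have h1 : σ ⁻¹' {j} = {σ⁻¹ j} := by
    ext i
    simp only [Set.mem_preimage, Set.mem_singleton_iff, Equiv.Perm.eq_inv_iff_eq]
  rw [Measure.map_apply (measurable_of_countable _) (measurableSet_singleton j), h1,
    weightMeasure_singleton, withDensity_apply _ (measurableSet_singleton j),
    lintegral_singleton, weightMeasure_singleton,
    ← ENNReal.ofReal_mul (div_nonneg (hm _).le (hm _).le), div_mul_cancel₀ _ (hm j).ne']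

lemma measurable_permAction (e : X ≃ᵐ J × ℝ) (σ : Equiv.Perm J) :
    Measurable (permAction e σ) := by
  have h1 : Measurable fun x => (σ (e x).1, (e x).2) :=
    ((measurable_of_countable σ).comp (measurable_fst.comp e.measurable)).prodMk
      (measurable_snd.comp e.measurable)
  exact e.symm.measurable.comp h1

variable {μ : Measure X} {m : J → ℝ}

/-- Only the finite coordinate of the product moves, so the density is the ratio of the masses of
two pieces. -/
lemma map_permAction (hm : ∀ j, 0 < m j) (h1 : ∑ j, m j = 1) {e : X ≃ᵐ J × ℝ}
    (he : MeasurePreserving e μ ((weightMeasure m).prod unitMeasure)) (σ : Equiv.Perm J) :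
    μ.map (permAction e σ) =
      μ.withDensity fun x => ENNReal.ofReal (m (σ⁻¹ (e x).1) / m (e x).1) := by
  have := isProbabilityMeasure_weightMeasure (fun j => (hm j).le) h1
  have hmeas : Measurable (Prod.map σ id : J × ℝ → J × ℝ) :=
    (measurable_of_countable σ).prodMap measurable_id
  have hg : Measurable fun j : J => ENNReal.ofReal (m (σ⁻¹ j) / m j) := measurable_of_countable _
  have hprod : ((weightMeasure m).prod unitMeasure).map (Prod.map σ id) =
      ((weightMeasure m).prod unitMeasure).withDensity
        fun z => ENNReal.ofReal (m (σ⁻¹ z.1) / m z.1) := by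
    rw [← prod_withDensity_left hg, ← map_weightMeasure hm, ← Measure.map_prod_map _ _
      (measurable_of_countable σ) measurable_id, Measure.map_id]
  have hcomp : (permAction e σ : X → X) = e.symm ∘ Prod.map σ id ∘ e := rfl
  rw [hcomp, ← Measure.map_map e.symm.measurable (hmeas.comp e.measurable),
    ← Measure.map_map hmeas e.measurable, he.map_eq, hprod]
  ext s hs
  rw [Measure.map_apply e.symm.measurable hs, withDensity_apply _ (e.symm.measurable hs),
    withDensity_apply _ hs, ← he.setLIntegral_comp_preimage_emb e.measurableEmbedding]
  congr 2
  ext x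
  simp

/-- The symmetric group of `J` acting by non-singular automorphisms. -/
def permAut (hm : ∀ j, 0 < m j) (h1 : ∑ j, m j = 1) {e : X ≃ᵐ J × ℝ}
    (he : MeasurePreserving e μ ((weightMeasure m).prod unitMeasure)) :
    Equiv.Perm J →* nonsingularGroup μ :=
  (permAction e).codRestrict (nonsingularGroup μ) fun σ => by
    have key : ∀ τ, Measure.QuasiMeasurePreserving (permAction e τ) μ μ := fun τ =>
      ⟨measurable_permAction e τ, by
        rw [map_permAction hm h1 he τ]; exact withDensity_absolutelyContinuous _ _⟩
    exact ⟨key σ, by rw [← map_inv]; exact key σ⁻¹⟩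

lemma coe_permAut (hm : ∀ j, 0 < m j) (h1 : ∑ j, m j = 1) {e : X ≃ᵐ J × ℝ}
    (he : MeasurePreserving e μ ((weightMeasure m).prod unitMeasure)) (σ : Equiv.Perm J) :
    (permAut hm h1 he σ : Equiv.Perm X) = permAction e σ := rfl

lemma rnDeriv_permAut [IsFiniteMeasure μ] (hm : ∀ j, 0 < m j) (h1 : ∑ j, m j = 1) {e : X ≃ᵐ J × ℝ}
    (he : MeasurePreserving e μ ((weightMeasure m).prod unitMeasure)) (σ : Equiv.Perm J) :
    ∀ᵐ x ∂μ, ((μ.map (permAut hm h1 he σ : Equiv.Perm X)).rnDeriv μ x).toReal =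
      m (σ⁻¹ (e x).1) / m (e x).1 := by
  have hg : Measurable fun x => ENNReal.ofReal (m (σ⁻¹ (e x).1) / m (e x).1) :=
    (measurable_of_countable fun j : J => ENNReal.ofReal (m (σ⁻¹ j) / m j)).comp
      (measurable_fst.comp e.measurable)
  rw [coe_permAut, map_permAction hm h1 he σ]
  filter_upwards [Measure.rnDeriv_withDensity μ hg] with x hx
  rw [hx, ENNReal.toReal_ofReal (div_nonneg (hm _).le (hm _).le)]

lemma measureReal_fst_mem (hm : ∀ j, 0 < m j) {e : X ≃ᵐ J × ℝ}
    (he : MeasurePreserving e μ ((weightMeasure m).prod unitMeasure)) (s : Finset J) :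
    μ.real {x | (e x).1 ∈ s} = ∑ j ∈ s, m j := by
  have h2 : {x | (e x).1 ∈ s} = e ⁻¹' ((s : Set J) ×ˢ Set.univ) := by
    ext x; simp
  rw [measureReal_def, h2, he.measure_preimage_equiv, Measure.prod_prod,
    weightMeasure_apply m (fun j => (hm j).le), measure_univ, mul_one,
    ENNReal.toReal_ofReal (Finset.sum_nonneg fun j _ => (hm j).le)]

/-- A non-atomic standard Borel probability space with a finite partition can be cut into pieces of
prescribed masses, compatibly with the partition. -/
theorem exists_measurableEquiv_prod {I : Type*} [Fintype I] [DecidableEq I] [MeasurableSpace I]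
    [MeasurableSingletonClass I] [StandardBorelSpace X]
    [IsProbabilityMeasure μ] [NullSingletonClass μ] {q : X → I} (hq : Measurable q)
    (hm : ∀ j, 0 < m j) (h1 : ∑ j, m j = 1) (p : J → I)
    (hp : ∀ i, ∑ j with p j = i, m j = μ.real (q ⁻¹' {i})) :
    ∃ e : X ≃ᵐ J × ℝ, MeasurePreserving e μ ((weightMeasure m).prod unitMeasure) ∧
      ∀ᵐ x ∂μ, p (e x).1 = q x := by
  have := isProbabilityMeasure_weightMeasure (fun j => (hm j).le) h1
  refine exists_measurableEquiv_of_measureReal_eq (q' := fun z : J × ℝ => p z.1) μ _ hq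
    ((measurable_of_countable p).comp measurable_fst) fun i => ?_
  have h2 : (fun z : J × ℝ => p z.1) ⁻¹' {i} =
      ((Finset.univ.filter fun j => p j = i : Finset J) : Set J) ×ˢ Set.univ := by
    ext z; simp
  rw [← hp i, h2, measureReal_def, Measure.prod_prod,
    weightMeasure_apply m (fun j => (hm j).le), measure_univ, mul_one,
    ENNReal.toReal_ofReal (Finset.sum_nonneg fun j _ => (hm j).le)]

end PermAction

/-! ### Cutting cells into pieces of geometric scales -/

section Pieces

open Finset

lemma exists_injective_of_card_fiber_le {A B K : Type*} [Fintype A] [Fintype B] [DecidableEq K]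
    (f : A → K) (g : B → K) (h : ∀ κ, #{a | f a = κ} ≤ #{b | g b = κ}) :
    ∃ φ : A → B, Function.Injective φ ∧ ∀ a, g (φ a) = f a := by
  have h1 : ∀ κ, Nonempty ({a // f a = κ} ↪ {b // g b = κ}) := fun κ => by
    refine Function.Embedding.nonempty_of_card_le ?_
    rw [Fintype.card_subtype, Fintype.card_subtype]
    exact h κ
  let emb := fun κ => (h1 κ).some
  have h2 : ∀ a κ (ha : f a = κ), (emb κ ⟨a, ha⟩ : B) = emb (f a) ⟨a, rfl⟩ := by
    rintro a _ rfl; rfl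
  refine ⟨fun a => emb (f a) ⟨a, rfl⟩, fun a a' haa => ?_, fun a => (emb (f a) ⟨a, rfl⟩).2⟩
  have h3 : f a' = f a := by
    rw [← (emb (f a) ⟨a, rfl⟩).2, ← (emb (f a') ⟨a', rfl⟩).2]
    exact congrArg g haa.symm
  have h4 : (emb (f a) ⟨a, rfl⟩ : B) = emb (f a) ⟨a', h3⟩ := by
    rw [h2 a' (f a) h3]; exact haa
  exact congrArg Subtype.val ((emb (f a)).injective (Subtype.ext h4))

lemma exists_perm_extending {J : Type*} [Finite J] {D : J → Prop} (φ : {j // D j} → J)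
    (hφ : Function.Injective φ) : ∃ τ : Equiv.Perm J, ∀ j (hj : D j), τ j = φ ⟨j, hj⟩ := by
  classical
  let e : {j // D j} ≃ {j // j ∈ Set.range φ} := Equiv.ofInjective φ hφ
  refine ⟨e.extendSubtype, fun j hj => ?_⟩
  rw [Equiv.extendSubtype_apply_of_mem _ j hj]
  rfl

/-- Cutting each cell `i` of a finite partition into pieces, in such a way that for each scale
`κ < M` the fraction `1 / M` of the cell is taken by pieces of mass about `w * r ^ κ`. -/
structure PieceSystem {I : Type u} (mass : I → ℝ) (r : ℝ) (M : ℕ) (w : ℝ) where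
  /-- The set of pieces. -/
  J : Type u
  [fintype : Fintype J]
  /-- The cell containing a piece. -/
  cell : J → I
  /-- The scale of a piece. -/
  scale : J → ℤ
  /-- The mass of a piece. -/
  m : J → ℝ
  scale_nonneg : ∀ j, 0 ≤ scale j
  scale_lt : ∀ j, scale j < M
  le_m : ∀ j, w * r ^ scale j ≤ m j
  m_le : ∀ j, m j ≤ w * r ^ (scale j + 1)
  sum_m : ∀ (i : I) (κ : ℤ), 0 ≤ κ → κ < M →
    open Classical in ∑ j with cell j = i ∧ scale j = κ, m j = mass i / M

attribute [instance] PieceSystem.fintype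

lemma exists_pieceSystem {I : Type u} [Fintype I] {mass : I → ℝ} (h0 : ∀ i, 0 ≤ mass i) {r : ℝ}
    (hr : 1 < r) {M : ℕ} (hM : 0 < M) {w : ℝ} (hw : 0 < w)
    (hsmall : ∀ i, 0 < mass i → w * (M * r ^ (M + 1)) ≤ mass i * (r - 1)) :
    Nonempty (PieceSystem mass r M w) := by
  classical
  have hr0 : 0 < r := one_pos.trans hr
  have hM0 : (0 : ℝ) < M := Nat.cast_pos.2 hM
  -- The ideal number of pieces of mass w r^k in the share 1/M of cell i. Rounding it down and
  -- dividing the share equally makes the pieces slightly heavier than w r^k.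
  let x : I → ℕ → ℝ := fun i k => mass i / (M * (w * r ^ k))
  let n : I → ℕ → ℕ := fun i k => ⌊x i k⌋₊
  have hx0 : ∀ i k, 0 ≤ x i k := fun i k => div_nonneg (h0 i) (by positivity)
  have hnx : ∀ i k, (n i k : ℝ) ≤ x i k := fun i k => Nat.floor_le (hx0 i k)
  -- By `hsmall`, x ≥ r/(r − 1), so rounding down costs at most a factor r.
  have hxn : ∀ i k, 0 < mass i → k < M → x i k ≤ r * n i k := by
    intro i k hi hk
    have h1 : r ≤ x i k * (r - 1) := by
      change r ≤ mass i / (M * (w * r ^ k)) * (r - 1)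
      rw [div_mul_eq_mul_div, le_div_iff₀ (by positivity)]
      refine le_trans ?_ (hsmall i hi)
      have : r ^ (k + 1) ≤ r ^ (M + 1) := pow_le_pow_right₀ hr.le (by omega)
      calc r * (M * (w * r ^ k)) = w * (M * r ^ (k + 1)) := by ring
        _ ≤ _ := by gcongr
    have h2 : x i k < n i k + 1 := Nat.lt_floor_add_one _
    nlinarith
  have hn0 : ∀ i k, 0 < mass i → k < M → (0 : ℝ) < n i k := by
    intro i k hi hk
    have h1 : 0 < x i k := div_pos hi (by positivity)
    have h2 := h1.trans_le (hxn i k hi hk)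
    exact (pos_iff_pos_of_mul_pos h2).1 hr0
  -- Cells of mass zero receive no pieces, so every piece has positive mass.
  let J := Σ y : {i // 0 < mass i} × Fin M, Fin (n y.1 y.2)
  refine ⟨{ J := J, cell := fun j => j.1.1, scale := fun j => ((j.1.2 : ℕ) : ℤ),
            m := fun j => mass j.1.1 / (M * n j.1.1 j.1.2), scale_nonneg := ?_, scale_lt := ?_,
            le_m := ?_, m_le := ?_, sum_m := ?_ }⟩
  · exact fun j => by positivity
  · exact fun j => by exact_mod_cast j.1.2.2
  · rintro ⟨⟨⟨i, hi⟩, k⟩, a⟩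
    have h1 := hnx i k
    have h2 := hn0 i k hi k.2
    simp only [zpow_natCast]
    rw [le_div_iff₀ (by positivity)]
    calc w * r ^ (k : ℕ) * (M * n i k) ≤ w * r ^ (k : ℕ) * (M * x i k) := by gcongr
      _ = mass i := by
        simp only [x]
        field_simp
  · rintro ⟨⟨⟨i, hi⟩, k⟩, a⟩
    have h1 := hxn i k hi k.2
    have h2 := hn0 i k hi k.2
    simp only
    rw [div_le_iff₀ (by positivity), zpow_add₀ hr0.ne', zpow_natCast, zpow_one]
    calc mass i = w * r ^ (k : ℕ) * (M * x i k) := by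
          simp only [x]
          field_simp
      _ ≤ w * r ^ (k : ℕ) * (M * (r * n i k)) := by gcongr
      _ = _ := by ring
  · intro i κ hκ hκM
    lift κ to ℕ using hκ
    have hκ' : κ < M := by exact_mod_cast hκM
    rw [sum_filter, Fintype.sum_sigma]
    have h1 : ∀ y : {i // 0 < mass i} × Fin M,
        (∑ _a : Fin (n y.1 y.2), if (y.1 : I) = i ∧ (((y.2 : ℕ) : ℤ) = κ) then
          mass y.1 / (M * n y.1 y.2) else 0) =
        if (y.1 : I) = i ∧ y.2 = ⟨κ, hκ'⟩ then mass i / M else 0 := by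
      rintro ⟨⟨i', hi'⟩, k⟩
      have h2 := hn0 i' k hi' k.2
      have h3 : (((k : ℕ) : ℤ) = κ) ↔ k = ⟨κ, hκ'⟩ := by
        rw [Fin.ext_iff]; exact Nat.cast_inj
      simp only [h3]
      split_ifs with h
      · rw [sum_const, card_univ, Fintype.card_fin, nsmul_eq_mul, ← h.1]
        field_simp
      · simp
    refine (sum_congr rfl fun y _ => h1 y).trans ?_
    by_cases hi : 0 < mass i
    · rw [sum_eq_single (⟨i, hi⟩, ⟨κ, hκ'⟩)]
      · simp
      · rintro ⟨i', k⟩ _ hne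
        rw [if_neg]
        rintro ⟨ha, hb⟩
        exact hne (Prod.ext (Subtype.ext ha) hb)
      · simp
    · have hz : mass i = 0 := le_antisymm (not_lt.1 hi) (h0 i)
      rw [hz]
      simp

namespace PieceSystem

variable {I : Type u} {mass : I → ℝ} {r : ℝ} {M : ℕ} {w : ℝ} (S : PieceSystem mass r M w)

lemma m_pos (hr : 1 < r) (hw : 0 < w) (j : S.J) : 0 < S.m j :=
  lt_of_lt_of_le (by have := one_pos.trans hr; positivity) (S.le_m j)

open Classical in
lemma sum_m_le (h0 : ∀ i, 0 ≤ mass i) (i : I) (κ : ℤ) :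
    ∑ j with S.cell j = i ∧ S.scale j = κ, S.m j ≤ mass i / M := by
  by_cases hκ : 0 ≤ κ ∧ κ < M
  · exact (S.sum_m i κ hκ.1 hκ.2).le
  · rw [filter_eq_empty_iff.2, sum_empty]
    · exact div_nonneg (h0 i) (Nat.cast_nonneg M)
    · rintro j _ ⟨_, rfl⟩
      exact hκ ⟨S.scale_nonneg j, S.scale_lt j⟩

open Classical in
lemma sum_cell_filter (i : I) (p : ℤ → Prop) :
    ∑ j with S.cell j = i ∧ p (S.scale j), S.m j = #{κ ∈ Ico (0 : ℤ) M | p κ} * (mass i / M) := by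
  rw [← sum_fiberwise_of_maps_to (s := univ.filter fun j => S.cell j = i ∧ p (S.scale j))
    (t := (Ico (0 : ℤ) M).filter p) (g := S.scale)]
  · rw [← nsmul_eq_mul, ← sum_const]
    refine sum_congr rfl fun κ hκ => ?_
    obtain ⟨hκ1, hκ2⟩ := mem_filter.1 hκ
    rw [mem_Ico] at hκ1
    rw [← S.sum_m i κ hκ1.1 hκ1.2]
    refine sum_congr ?_ fun _ _ => rfl
    ext j
    simp only [mem_filter, mem_univ, true_and]
    constructor
    · rintro ⟨⟨h1, _⟩, h2⟩
      exact ⟨h1, h2⟩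
    · rintro ⟨h1, h2⟩
      exact ⟨⟨h1, h2 ▸ hκ2⟩, h2⟩
  · intro j hj
    obtain ⟨_, hj⟩ := mem_filter.1 hj
    exact mem_filter.2 ⟨mem_Ico.2 ⟨S.scale_nonneg j, S.scale_lt j⟩, hj.2⟩

open Classical in
lemma sum_cell (hM : 0 < M) (i : I) : ∑ j with S.cell j = i, S.m j = mass i := by
  have h := S.sum_cell_filter i fun _ => True
  simp only [and_true, filter_true, Int.card_Ico, sub_zero, Int.toNat_natCast] at h
  rw [h]
  have : (M : ℝ) ≠ 0 := by positivity
  field_simp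

lemma sum_m_eq [Fintype I] (hM : 0 < M) : ∑ j, S.m j = ∑ i, mass i := by
  classical
  rw [← sum_fiberwise univ S.cell]
  exact sum_congr rfl fun i _ => S.sum_cell hM i

/-- Scales are nonnegative and r > 1, so each piece has mass at least w. -/
lemma card_mul_le [Fintype I] (hM : 0 < M) (hr : 1 < r) (hw : 0 < w) :
    Fintype.card S.J * w ≤ ∑ i, mass i := by
  rw [← S.sum_m_eq hM]
  calc Fintype.card S.J * w = ∑ _j : S.J, w := by simp
    _ ≤ _ := sum_le_sum fun j _ => by
      refine le_trans ?_ (S.le_m j)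
      exact le_mul_of_one_le_right hw.le (one_le_zpow₀ hr.le (S.scale_nonneg j))

lemma m_le_bound (hr : 1 < r) (hw : 0 < w) (j : S.J) : S.m j ≤ w * r ^ M := by
  refine (S.m_le j).trans ?_
  rw [← zpow_natCast r M]
  have := S.scale_lt j
  gcongr
  · exact hr.le
  · omega

open Classical in
/-- Few pieces leave the range of scales under bounded shifts. -/
lemma sum_out_of_range_le [Fintype I] (h0 : ∀ i, 0 ≤ mass i) (s : I → ℤ) {L : ℕ}
    (hs : ∀ i, |s i| ≤ L) :
    ∑ j with ¬ (0 ≤ S.scale j + s (S.cell j) ∧ S.scale j + s (S.cell j) < M), S.m j ≤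
      L / M * ∑ i, mass i := by
  rw [← sum_fiberwise _ S.cell, mul_sum]
  refine sum_le_sum fun i _ => ?_
  have h1 := S.sum_cell_filter i fun κ => ¬ (0 ≤ κ + s i ∧ κ + s i < M)
  -- A shift by s i pushes out at most |s i| scales, at the top or the bottom according to its sign.
  have h2 : #{κ ∈ Ico (0 : ℤ) M | ¬ (0 ≤ κ + s i ∧ κ + s i < M)} ≤ L := by
    have hsub : {κ ∈ Ico (0 : ℤ) M | ¬ (0 ≤ κ + s i ∧ κ + s i < M)} ⊆
        if 0 ≤ s i then Ico ((M : ℤ) - s i) M else Ico 0 (- s i) := by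
      intro κ hκ
      simp only [mem_filter, mem_Ico] at hκ
      split_ifs with h <;> rw [mem_Ico] <;> omega
    refine (card_le_card hsub).trans ?_
    have := hs i
    rw [abs_le] at this
    split_ifs with h <;> rw [Int.card_Ico] <;> omega
  calc _ = ∑ j with S.cell j = i ∧ ¬ (0 ≤ S.scale j + s i ∧ S.scale j + s i < M), S.m j := by
        refine sum_congr ?_ fun _ _ => rfl
        ext j
        simp only [mem_filter, mem_univ, true_and]
        constructor
        · rintro ⟨ha, rfl⟩
          exact ⟨rfl, ha⟩
        · rintro ⟨rfl, ha⟩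
          exact ⟨ha, rfl⟩
    _ ≤ L * (mass i / M) := by
        refine (le_of_eq (by convert h1)).trans (mul_le_mul_of_nonneg_right (b := (_ : ℝ)) ?_
          (div_nonneg (h0 i) (Nat.cast_nonneg M)))
        exact_mod_cast h2
    _ = _ := by ring

/-- A permutation of the pieces which rescales the masses by prescribed factors and moves the pieces
into prescribed classes of cells. -/
lemma exists_perm [Fintype I] (h0 : ∀ i, 0 ≤ mass i) (hr : 1 < r) (hw : 0 < w)
    {P : Type*} (p₀ p : I → P) (s : I → ℤ) (good : I → Prop)
    (h : ∀ c, open Classical in ∑ i with p i = c ∧ good i, mass i * r ^ (s i + 1) ≤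
      ∑ i with p₀ i = c, mass i) :
    ∃ τ : Equiv.Perm S.J, ∀ j, good (S.cell j) → 0 ≤ S.scale j + s (S.cell j) →
      S.scale j + s (S.cell j) < M → p₀ (S.cell (τ j)) = p (S.cell j) ∧
        r ^ (s (S.cell j) - 1) * S.m j ≤ S.m (τ j) := by
  classical
  have hr0 : 0 < r := one_pos.trans hr
  -- D singles out the pieces to be controlled; f records the class and scale wanted for the target,
  -- g those available. An injection exists if no pair is demanded more often than supplied, and
  -- both counts are compared after multiplication by w r^(κ+1).
  let D : S.J → Prop := fun j => good (S.cell j) ∧ 0 ≤ S.scale j + s (S.cell j) ∧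
    S.scale j + s (S.cell j) < M
  let f : {j // D j} → P × ℤ := fun j => (p (S.cell j), S.scale j + s (S.cell j))
  let g : S.J → P × ℤ := fun j => (p₀ (S.cell j), S.scale j)
  obtain ⟨φ, hφ, hgf⟩ := exists_injective_of_card_fiber_le f g <| by
    rintro ⟨c, κ⟩
    by_cases hκ : 0 ≤ κ ∧ κ < M
    swap
    · rw [filter_eq_empty_iff.2, card_empty]
      · exact Nat.zero_le _
      · rintro ⟨j, hj⟩ _ hf
        have : S.scale j + s (S.cell j) = κ := congrArg Prod.snd hf
        exact hκ (this ▸ hj.2)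
    have hpos : 0 < w * r ^ (κ + 1) := by positivity
    have hsupply : ∑ i with p₀ i = c, mass i / M ≤ #{j | g j = (c, κ)} * (w * r ^ (κ + 1)) := by
      calc ∑ i with p₀ i = c, mass i / M
          = ∑ i with p₀ i = c, ∑ j with S.cell j = i ∧ S.scale j = κ, S.m j :=
            sum_congr rfl fun i _ => (S.sum_m i κ hκ.1 hκ.2).symm
        _ = ∑ j with g j = (c, κ), S.m j := by
            rw [← sum_fiberwise_of_maps_to (s := univ.filter fun j => g j = (c, κ))
              (t := univ.filter fun i => p₀ i = c) (g := S.cell)]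
            · refine sum_congr rfl fun i hi => sum_congr ?_ fun _ _ => rfl
              have hi' := (mem_filter.1 hi).2
              ext j
              simp only [mem_filter, mem_univ, true_and, g, Prod.mk.injEq]
              constructor
              · rintro ⟨rfl, hb⟩
                exact ⟨⟨hi', hb⟩, rfl⟩
              · rintro ⟨⟨_, hb⟩, ha⟩
                exact ⟨ha, hb⟩
            · intro j hj
              have := (mem_filter.1 hj).2
              exact mem_filter.2 ⟨mem_univ _, congrArg Prod.fst this⟩
        _ ≤ ∑ j with g j = (c, κ), w * r ^ (κ + 1) := sum_le_sum fun j hj => by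
            have : S.scale j = κ := congrArg Prod.snd (mem_filter.1 hj).2
            rw [← this]
            exact S.m_le j
        _ = _ := by rw [sum_const, nsmul_eq_mul]
    -- A piece asking for scale κ has scale κ − s and mass at least w r^(κ−s); hence the factor
    -- r^(s+1) in `h`.
    have hdemand : #{d | f d = (c, κ)} * (w * r ^ (κ + 1)) ≤ ∑ i with p₀ i = c, mass i / M := by
      calc #{d | f d = (c, κ)} * (w * r ^ (κ + 1))
          = ∑ d with f d = (c, κ), w * r ^ (κ + 1) := by rw [sum_const, nsmul_eq_mul]
        _ ≤ ∑ d with f d = (c, κ), r ^ (s (S.cell d) + 1) * S.m d := sum_le_sum fun d hd => by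
            have : S.scale d + s (S.cell d) = κ := congrArg Prod.snd (mem_filter.1 hd).2
            rw [← this]
            calc w * r ^ (S.scale d + s (S.cell d) + 1)
                = r ^ (s (S.cell d) + 1) * (w * r ^ S.scale d) := by
                  rw [add_assoc, zpow_add₀ hr0.ne']; ring
              _ ≤ _ := by gcongr; exact S.le_m d
        _ = ∑ j ∈ (univ.filter fun d => f d = (c, κ)).map (Function.Embedding.subtype _),
              r ^ (s (S.cell j) + 1) * S.m j := by rw [sum_map]; rfl
        _ = ∑ i with p i = c ∧ good i, ∑ j ∈ (univ.filter fun d => f d = (c, κ)).map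
              (Function.Embedding.subtype _) with S.cell j = i,
              r ^ (s (S.cell j) + 1) * S.m j := by
            refine (sum_fiberwise_of_maps_to ?_ _).symm
            intro j hj
            simp only [Finset.mem_map, mem_filter, mem_univ, true_and, Function.Embedding.subtype_apply]
              at hj
            obtain ⟨d, hd, rfl⟩ := hj
            exact mem_filter.2 ⟨mem_univ _, congrArg Prod.fst hd, d.2.1⟩
        _ ≤ ∑ i with p i = c ∧ good i, r ^ (s i + 1) * (mass i / M) := by
            refine sum_le_sum fun i _ => ?_
            calc _ = r ^ (s i + 1) * ∑ j ∈ (univ.filter fun d => f d = (c, κ)).map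
                    (Function.Embedding.subtype _) with S.cell j = i, S.m j := by
                  rw [mul_sum]
                  refine sum_congr rfl fun j hj => ?_
                  rw [(mem_filter.1 hj).2]
              _ ≤ r ^ (s i + 1) * ∑ j with S.cell j = i ∧ S.scale j = κ - s i, S.m j := by
                  refine mul_le_mul_of_nonneg_left (sum_le_sum_of_subset_of_nonneg ?_
                    fun j _ _ => (S.m_pos hr hw j).le) (by positivity)
                  intro j hj
                  obtain ⟨hj1, hj2⟩ := mem_filter.1 hj
                  simp only [Finset.mem_map, mem_filter, mem_univ, true_and,
                    Function.Embedding.subtype_apply] at hj1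
                  obtain ⟨d, hd, rfl⟩ := hj1
                  have : S.scale d + s (S.cell d) = κ := congrArg Prod.snd hd
                  rw [hj2] at this
                  exact mem_filter.2 ⟨mem_univ _, hj2, by omega⟩
              _ ≤ _ := by
                  gcongr
                  exact S.sum_m_le h0 i _
        _ = (∑ i with p i = c ∧ good i, mass i * r ^ (s i + 1)) / M := by
            rw [sum_div]
            exact sum_congr rfl fun i _ => by ring
        _ ≤ _ := by
            rw [← sum_div]
            gcongr
            exact h c
    have := le_of_mul_le_mul_right (hdemand.trans hsupply) hpos
    exact_mod_cast this
  obtain ⟨τ, hτ⟩ := exists_perm_extending φ hφ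
  refine ⟨τ, fun j h1 h2 h3 => ?_⟩
  have hj : D j := ⟨h1, h2, h3⟩
  have hkey := hgf ⟨j, hj⟩
  rw [← hτ j hj] at hkey
  refine ⟨congrArg Prod.fst hkey, ?_⟩
  have hsc : S.scale (τ j) = S.scale j + s (S.cell j) := congrArg Prod.snd hkey
  -- The piece may weigh up to w r^(scale+1) and its target only w r^(scale+s), which costs one
  -- factor r.
  calc r ^ (s (S.cell j) - 1) * S.m j
      ≤ r ^ (s (S.cell j) - 1) * (w * r ^ (S.scale j + 1)) := by
        gcongr
        exact S.m_le j
    _ = w * r ^ S.scale (τ j) := by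
        rw [hsc, mul_left_comm, ← zpow_add₀ hr0.ne']
        congr 2
        ring
    _ ≤ _ := S.le_m _

end PieceSystem

end Pieces

/-! ### Approximating automorphisms by permutations of pieces -/

section Approximation

open Finset

variable {X : Type u} [MeasurableSpace X] {μ : Measure X}

/-- Since T⁻¹ is non-singular as well, μ ≪ T_*μ; this makes the logarithm of the density meaningful.
-/
lemma rnDeriv_map_toReal_pos [IsFiniteMeasure μ] (T : nonsingularGroup μ) :
    ∀ᵐ y ∂μ, 0 < ((μ.map (T : Equiv.Perm X)).rnDeriv μ y).toReal := by
  have hac : μ ≪ μ.map (T : Equiv.Perm X) := by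
    have h1 := T.2.2.absolutelyContinuous.map T.2.1.measurable
    rw [Measure.map_map T.2.1.measurable T.2.2.measurable] at h1
    have h2 : ((T : Equiv.Perm X) ∘ ((T : Equiv.Perm X)⁻¹ : Equiv.Perm X) : X → X) = id := by
      ext x; exact perm_apply_inv _ x
    rwa [h2, Measure.map_id] at h1
  filter_upwards [Measure.rnDeriv_pos' hac, Measure.rnDeriv_lt_top (μ.map (T : Equiv.Perm X)) μ]
    with y h1 h2
  exact ENNReal.toReal_pos h1.ne' h2.ne

/-- The integer `s` with `r ^ (s + 1) ≤ ρ < r ^ (s + 2)`, where `ρ` is the density of `T`. -/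
def densityLevel (μ : Measure X) (r : ℝ) (T : Equiv.Perm X) (y : X) : ℤ :=
  -- The shift by 1 fits the exponent s + 1 in the hypothesis of `PieceSystem.exists_perm`.
  ⌊Real.log ((μ.map T).rnDeriv μ y).toReal / Real.log r⌋ - 1

lemma measurable_densityLevel (r : ℝ) (T : Equiv.Perm X) : Measurable (densityLevel μ r T) := by
  have h1 : Measurable fun y => Real.log ((μ.map T).rnDeriv μ y).toReal / Real.log r :=
    ((Measure.measurable_rnDeriv _ _).ennreal_toReal.log).div_const _
  exact (measurable_of_countable fun k : ℤ => k - 1).comp (Int.measurable_floor.comp h1)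

lemma densityLevel_spec [IsFiniteMeasure μ] {r : ℝ} (hr : 1 < r) (T : nonsingularGroup μ) :
    ∀ᵐ y ∂μ, r ^ (densityLevel μ r T y + 1) ≤
        ((μ.map (T : Equiv.Perm X)).rnDeriv μ y).toReal ∧
      ((μ.map (T : Equiv.Perm X)).rnDeriv μ y).toReal ≤ r ^ (densityLevel μ r T y + 2) := by
  filter_upwards [rnDeriv_map_toReal_pos T] with y hy
  set ρ := ((μ.map (T : Equiv.Perm X)).rnDeriv μ y).toReal with hρ
  have hr0 : 0 < r := one_pos.trans hr
  have hlog : 0 < Real.log r := Real.log_pos hr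
  have e1 : densityLevel μ r T y + 1 = ⌊Real.log ρ / Real.log r⌋ := by
    rw [densityLevel]; ring
  have e2 : densityLevel μ r T y + 2 = ⌊Real.log ρ / Real.log r⌋ + 1 := by
    rw [densityLevel]; ring
  have h1 := Int.floor_le (Real.log ρ / Real.log r)
  have h2 := (Int.lt_floor_add_one (Real.log ρ / Real.log r)).le
  rw [le_div_iff₀ hlog] at h1
  rw [div_le_iff₀ hlog] at h2
  rw [e1, e2]
  constructor
  · rw [← Real.log_le_log_iff (by positivity) hy, Real.log_zpow]
    exact h1
  · rw [← Real.log_le_log_iff hy (by positivity), Real.log_zpow]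
    push_cast
    exact h2

lemma tendsto_measureReal_abs_gt [IsFiniteMeasure μ] {f : X → ℤ} (hf : Measurable f) :
    Tendsto (fun L : ℕ => μ.real {x | (L : ℤ) < |f x|}) atTop (𝓝 0) := by
  have hm : ∀ L : ℕ, MeasurableSet {x | (L : ℤ) < |f x|} := fun L =>
    hf (Set.to_countable {k : ℤ | (L : ℤ) < |k|}).measurableSet
  have h1 : Tendsto (fun L : ℕ => μ {x | (L : ℤ) < |f x|}) atTop
      (𝓝 (μ (⋂ L : ℕ, {x | (L : ℤ) < |f x|}))) := by
    refine tendsto_measure_iInter_atTop (fun L => (hm L).nullMeasurableSet) ?_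
      ⟨0, measure_ne_top _ _⟩
    intro a b hab x hx
    have h2 : (a : ℤ) ≤ b := by exact_mod_cast hab
    exact lt_of_le_of_lt h2 hx
  have h2 : (⋂ L : ℕ, {x | (L : ℤ) < |f x|}) = ∅ := by
    refine Set.eq_empty_of_forall_notMem fun x hx => ?_
    have := Set.mem_iInter.1 hx (f x).natAbs
    change (((f x).natAbs : ℕ) : ℤ) < |f x| at this
    rw [Int.natCast_natAbs] at this
    exact lt_irrefl _ this
  rw [h2, measure_empty] at h1
  exact (ENNReal.tendsto_toReal ENNReal.zero_ne_top).comp h1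

variable [IsProbabilityMeasure μ]

lemma measureReal_mul_le_of_le_rnDeriv (T : nonsingularGroup μ) {A : Set X} (hA : MeasurableSet A)
    {c : ℝ} (h : ∀ᵐ y ∂μ, y ∈ A → c ≤ ((μ.map (T : Equiv.Perm X)).rnDeriv μ y).toReal) :
    μ.real A * c ≤ μ.real ((T : Equiv.Perm X) ⁻¹' A) := by
  rw [← setIntegral_rnDeriv_map T hA]
  have h1 : ∫ _y in A, c ∂μ = μ.real A * c := by simp
  rw [← h1]
  exact setIntegral_mono_on_ae (integrable_const c).integrableOn
    Measure.integrable_toReal_rnDeriv.integrableOn hA h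

lemma measureReal_le_mul_of_rnDeriv_le (T : nonsingularGroup μ) {A : Set X} (hA : MeasurableSet A)
    {c : ℝ} (h : ∀ᵐ y ∂μ, y ∈ A → ((μ.map (T : Equiv.Perm X)).rnDeriv μ y).toReal ≤ c) :
    μ.real ((T : Equiv.Perm X) ⁻¹' A) ≤ μ.real A * c := by
  rw [← setIntegral_rnDeriv_map T hA]
  have h1 : ∫ _y in A, c ∂μ = μ.real A * c := by simp
  rw [← h1]
  exact setIntegral_mono_on_ae Measure.integrable_toReal_rnDeriv.integrableOn
    (integrable_const c).integrableOn hA h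

/-- An action of the symmetric group of a finite set `J` permuting pieces of `X`, all of which have
mass at most `b`. -/
structure PermModel (μ : Measure X) (b : ℝ) where
  /-- The set of pieces. -/
  J : Type u
  [fintype : Fintype J]
  [measurableSpace : MeasurableSpace J]
  [measurableSingletonClass : MeasurableSingletonClass J]
  /-- The masses of the pieces. -/
  m : J → ℝ
  /-- The identification of `X` with a product. -/
  e : X ≃ᵐ J × ℝ
  m_pos : ∀ j, 0 < m j
  m_le : ∀ j, m j ≤ b
  sum_m : ∑ j, m j = 1
  measurePreserving_e : MeasurePreserving e μ ((weightMeasure m).prod unitMeasure)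

attribute [instance] PermModel.fintype PermModel.measurableSpace PermModel.measurableSingletonClass

/-- The symmetric group acting on a model. -/
def PermModel.hom {b : ℝ} (S : PermModel μ b) : Equiv.Perm S.J →* nonsingularGroup μ :=
  permAut S.m_pos S.sum_m S.measurePreserving_e

/-- Compare with the identity, taking κ = 1: points of fixed pieces stay put with density 1, and
each moved piece has mass at most b. -/
lemma PermModel.norm_koopman_sub_sq_le {b : ℝ} (S : PermModel μ b) [DecidableEq S.J]
    (σ : Equiv.Perm S.J) {C : Set X} (hC : MeasurableSet C) :
    ‖koopman (S.hom σ) (indicatorL2 μ hC) - indicatorL2 μ hC‖ ^ 2 ≤ 2 * (b * permDist σ 1) := by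
  set Fx : Finset S.J := {j | σ j = j} with hFx
  have hBm : MeasurableSet {x | (S.e x).1 ∈ Fx} :=
    (measurable_fst.comp S.e.measurable) (Set.to_countable (Fx : Set S.J)).measurableSet
  have h1 := norm_koopman_indicator_sub_sq_le (S.hom σ) (1 : nonsingularGroup μ) hC hBm (κ := 1) <| by
    filter_upwards [rnDeriv_permAut S.m_pos S.sum_m S.measurePreserving_e σ,
      Measure.rnDeriv_self μ] with y h1 h2 hy
    have hfix : σ (S.e y).1 = (S.e y).1 := (mem_filter.1 hy).2
    have hfix' : σ⁻¹ (S.e y).1 = (S.e y).1 := by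
      rw [Equiv.Perm.inv_eq_iff_eq]; exact hfix.symm
    have h3 : ((S.hom σ : Equiv.Perm X))⁻¹ y = y := by
      rw [Equiv.Perm.inv_eq_iff_eq]
      exact (permAction_eq_self S.e hfix).symm
    have h4 : μ.map ((1 : nonsingularGroup μ) : Equiv.Perm X) = μ := by
      rw [OneMemClass.coe_one, Equiv.Perm.coe_one]
      exact Measure.map_id
    refine ⟨by rw [h3]; simp, ?_⟩
    rw [h4, h2, PermModel.hom, h1, hfix', div_self (S.m_pos _).ne']
    simp
  rw [koopman_one] at h1
  refine h1.trans ?_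
  have h5 : μ.real (((1 : nonsingularGroup μ) : Equiv.Perm X) ⁻¹' {x | (S.e x).1 ∈ Fx}) =
      ∑ j ∈ Fx, S.m j := measureReal_fst_mem S.m_pos S.measurePreserving_e Fx
  have h6 : ∑ j ∈ Fx, S.m j + ∑ j with ¬ σ j = j, S.m j = 1 := by
    rw [← S.sum_m]
    exact sum_filter_add_sum_filter_not univ _ _
  have h7 : ∑ j with ¬ σ j = j, S.m j ≤ b * permDist σ 1 := by
    calc _ ≤ ∑ j with ¬ σ j = j, b := sum_le_sum fun j _ => S.m_le j
      _ = _ := by rw [sum_const, nsmul_eq_mul, mul_comm]; rfl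
  rw [h5]
  linarith

lemma permDist_mul_inv {J : Type*} [Fintype J] [DecidableEq J] (σ τ : Equiv.Perm J) :
    permDist (σ * τ⁻¹) 1 = permDist σ τ := by
  unfold permDist
  refine card_bij (fun j _ => τ⁻¹ j) ?_ ?_ ?_
  · intro j hj
    have h := (mem_filter.1 hj).2
    refine mem_filter.2 ⟨mem_univ _, fun h' => h ?_⟩
    rw [Equiv.Perm.mul_apply, h', perm_apply_inv, Equiv.Perm.one_apply]
  · intro i _ j _ h
    exact τ⁻¹.injective h
  · intro j hj
    refine ⟨τ j, mem_filter.2 ⟨mem_univ _, ?_⟩, perm_inv_apply τ j⟩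
    rw [Equiv.Perm.mul_apply, perm_inv_apply, Equiv.Perm.one_apply]
    exact (mem_filter.1 hj).2

/-- The parameters are chosen in the order r, L, M, w: r limits the error in the densities, L
truncates extreme densities, M makes the loss at the ends of the scales small, and w makes b² · #J
small without spoiling the approximation. -/
theorem exists_permModel_near [StandardBorelSpace X] [NullSingletonClass μ]
    {Λ : Type u} [Finite Λ] (T : Λ → nonsingularGroup μ) (F : Finset {C : Set X // MeasurableSet C})
    {ε η : ℝ} (hε : 0 < ε) (hη : 0 < η) :
    ∃ (b : ℝ) (S : PermModel μ b), 0 ≤ b ∧ b ^ 2 * Fintype.card S.J ≤ η ∧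
      ∀ l, ∃ σ, ∀ C ∈ F, ‖koopman (S.hom σ) (indicatorL2 μ C.2) -
        koopman (T l) (indicatorL2 μ C.2)‖ ^ 2 ≤ ε := by
  classical
  cases nonempty_fintype Λ
  -- The final error is at most 2(1 − r⁻²(1 − ε/4)), so r⁻² ≥ 1 − ε/4 suffices.
  obtain ⟨r, hr, hrε⟩ : ∃ r : ℝ, 1 < r ∧ 1 - ε / 4 ≤ (r ^ 2)⁻¹ := by
    refine ⟨1 + ε / 8, by linarith, ?_⟩
    rw [← one_div, le_div_iff₀ (by positivity)]
    nlinarith [pow_pos hε 2, pow_pos hε 3]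
  have hr0 : 0 < r := one_pos.trans hr
  let ρ : Λ → X → ℝ := fun l y => ((μ.map (T l : Equiv.Perm X)).rnDeriv μ y).toReal
  let s₀ : Λ → X → ℤ := fun l => densityLevel μ r (T l : Equiv.Perm X)
  have hs₀m : ∀ l, Measurable (s₀ l) := fun l => measurable_densityLevel r _
  have hspec : ∀ l, ∀ᵐ y ∂μ, r ^ (s₀ l y + 1) ≤ ρ l y ∧ ρ l y ≤ r ^ (s₀ l y + 2) :=
    fun l => densityLevel_spec hr (T l)
  obtain ⟨L, hL⟩ : ∃ L : ℕ, ∀ l,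
      μ.real ((T l : Equiv.Perm X) ⁻¹' {y | (L : ℤ) < |s₀ l y|}) ≤ ε / 8 := by
    have h1 : ∀ᶠ L : ℕ in atTop, ∀ l,
        μ.real {x | (L : ℤ) < |s₀ l ((T l : Equiv.Perm X) x)|} ≤ ε / 8 := by
      refine eventually_all.2 fun l => ?_
      exact (tendsto_measureReal_abs_gt ((hs₀m l).comp (T l).2.1.measurable)).eventually_le_const
        (by positivity)
    exact h1.exists
  -- Pieces leaving the range of scales have mass at most L/M. Pulling back by T l enlarges this by
  -- at most the density bound r^(L+2) on the truncated set.
  obtain ⟨M, hM, hMε⟩ : ∃ M : ℕ, 0 < M ∧ r ^ ((L : ℤ) + 2) * (L / M) ≤ ε / 8 := by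
    have h1 : Tendsto (fun M : ℕ => r ^ ((L : ℤ) + 2) * ((L : ℝ) / M)) atTop (𝓝 0) := by
      simpa using (tendsto_const_div_atTop_nhds_zero_nat (L : ℝ)).const_mul (r ^ ((L : ℤ) + 2))
    exact ((eventually_gt_atTop 0).and (h1.eventually_le_const (by positivity))).exists
  let P : Type u := F → Prop
  let p : X → P := fun x C => x ∈ (C : {C : Set X // MeasurableSet C}).1
  have hpm : Measurable p := measurable_pi_lambda _ fun C =>
    measurableSet_setOfPred.1 C.1.2
  -- The extra value L + 1 marks points whose density level exceeds L in absolute value.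
  let Z : Type := Finset.Icc (-(L : ℤ)) (L + 1)
  let s₁ : Λ → X → Z := fun l y => if h : |s₀ l y| ≤ L then
    ⟨s₀ l y, by rw [abs_le] at h; rw [Finset.mem_Icc]; omega⟩ else
    ⟨L + 1, by rw [Finset.mem_Icc]; omega⟩
  have hs₁m : ∀ l, Measurable (s₁ l) := fun l =>
    (measurable_of_countable fun k : ℤ => if h : |k| ≤ L then
      (⟨k, by rw [abs_le] at h; rw [Finset.mem_Icc]; omega⟩ : Z) else
      ⟨L + 1, by rw [Finset.mem_Icc]; omega⟩).comp (hs₀m l)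
  let I : Type u := P × (Λ → P) × (Λ → Z)
  let q : X → I := fun y => (p y, fun l => p ((T l : Equiv.Perm X)⁻¹ y), fun l => s₁ l y)
  have hqm : Measurable q := hpm.prodMk ((measurable_pi_lambda _ fun l =>
    hpm.comp (T l).2.2.measurable).prodMk (measurable_pi_lambda _ hs₁m))
  have hqs : ∀ i, MeasurableSet (q ⁻¹' {i}) := fun i => hqm (measurableSet_singleton i)
  let mass : I → ℝ := fun i => μ.real (q ⁻¹' {i})
  have hmass0 : ∀ i, 0 ≤ mass i := fun i => measureReal_nonneg
  have hmass1 : ∑ i, mass i = 1 := by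
    have h1 := sum_measureReal_preimage_singleton (μ := μ) (f := q) univ fun i _ => hqs i
    rw [h1]
    simp
  let s : Λ → I → ℤ := fun l i => min (i.2.2 l).1 L
  let good : Λ → I → Prop := fun l i => (i.2.2 l).1 ≤ L
  have hsL : ∀ l i, |s l i| ≤ L := fun l i => by
    have := Finset.mem_Icc.1 (i.2.2 l).2
    rw [abs_le]
    simp only [s]
    omega
  have hgood : ∀ l y, good l (q y) → |s₀ l y| ≤ L ∧ s l (q y) = s₀ l y := by
    intro l y h
    have h1 : (s₁ l y).1 ≤ L := h
    have h2 : s l (q y) = min (s₁ l y).1 L := rfl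
    simp only [s₁] at h1 h2
    split_ifs at h1 h2 with h3
    · exact ⟨h3, h2.trans (min_eq_left h1)⟩
    · simp at h1
  have hgood' : ∀ l y, |s₀ l y| ≤ L → good l (q y) := by
    intro l y h
    change (s₁ l y).1 ≤ L
    simp only [s₁, dif_pos h]
    exact (abs_le.1 h).2
  obtain ⟨w, hw, hwη, hwsmall⟩ : ∃ w : ℝ, 0 < w ∧ w * (r ^ M) ^ 2 ≤ η ∧
      ∀ i, 0 < mass i → w * (M * r ^ (M + 1)) ≤ mass i * (r - 1) := by
    have lim : ∀ c : ℝ, Tendsto (fun w : ℝ => w * c) (𝓝[>] 0) (𝓝 0) := fun c => by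
      have : Tendsto (fun w : ℝ => w * c) (𝓝 0) (𝓝 (0 * c)) := tendsto_id.mul_const c
      rw [zero_mul] at this
      exact this.mono_left nhdsWithin_le_nhds
    have h1 : ∀ᶠ w : ℝ in 𝓝[>] 0, 0 < w := eventually_mem_nhdsWithin
    have h2 := (lim ((r ^ M) ^ 2)).eventually_le_const hη
    have h3 : ∀ᶠ w : ℝ in 𝓝[>] 0, ∀ i, 0 < mass i →
        w * (M * r ^ (M + 1)) ≤ mass i * (r - 1) := by
      refine eventually_all.2 fun i => ?_
      by_cases hi : 0 < mass i
      · filter_upwards [(lim (M * r ^ (M + 1))).eventually_le_const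
          (mul_pos hi (sub_pos.2 hr))] with w hw _
        exact hw
      · exact .of_forall fun w h => absurd h hi
    exact (h1.and (h2.and h3)).exists
  obtain ⟨S⟩ := exists_pieceSystem hmass0 hr hM hw hwsmall
  let _ : MeasurableSpace S.J := ⊤
  have hSpos : ∀ j, 0 < S.m j := S.m_pos hr hw
  have hSsum : ∑ j, S.m j = 1 := (S.sum_m_eq hM).trans hmass1
  obtain ⟨e, he, heq⟩ := exists_measurableEquiv_prod (μ := μ) hqm hSpos hSsum S.cell fun i => by
    convert S.sum_cell hM i
  let N : PermModel μ (w * r ^ M) :=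
    { J := S.J, m := S.m, e := e, m_pos := hSpos, m_le := S.m_le_bound hr hw, sum_m := hSsum,
      measurePreserving_e := he }
  refine ⟨w * r ^ M, N, by positivity, ?_, fun l => ?_⟩
  · have h1 := S.card_mul_le hM hr hw
    rw [hmass1] at h1
    calc (w * r ^ M) ^ 2 * Fintype.card S.J = w * (r ^ M) ^ 2 * (Fintype.card S.J * w) := by ring
      _ ≤ η * 1 := by gcongr
      _ = η := mul_one η
  -- The cells where T l⁻¹y has class c have as preimage under T l exactly the set of points of
  -- class c. Lower density bounds on the good ones therefore add up to at most the mass of that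
  -- class.
  have hdemand : ∀ c : P, ∑ i with i.2.1 l = c ∧ good l i, mass i * r ^ (s l i + 1) ≤
      ∑ i : I with i.1 = c, mass i := by
    intro c
    have hT : Measurable (T l : Equiv.Perm X) := (T l).2.1.measurable
    calc ∑ i with i.2.1 l = c ∧ good l i, mass i * r ^ (s l i + 1)
        ≤ ∑ i with i.2.1 l = c ∧ good l i, μ.real ((T l : Equiv.Perm X) ⁻¹' (q ⁻¹' {i})) := by
          refine sum_le_sum fun i hi => ?_
          refine measureReal_mul_le_of_le_rnDeriv (T l) (hqs i) ?_
          filter_upwards [hspec l] with y hy hyi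
          have hyi' : q y = i := hyi
          have h2 : good l (q y) := hyi' ▸ (mem_filter.1 hi).2.2
          rw [← hyi', (hgood l y h2).2]
          exact hy.1
      _ ≤ ∑ i : I with i.2.1 l = c, μ.real ((T l : Equiv.Perm X) ⁻¹' (q ⁻¹' {i})) := by
          refine sum_le_sum_of_subset_of_nonneg ?_ fun _ _ _ => measureReal_nonneg
          intro i hi
          exact mem_filter.2 ⟨mem_univ _, (mem_filter.1 hi).2.1⟩
      _ = μ.real ((fun x => q ((T l : Equiv.Perm X) x)) ⁻¹'
            (univ.filter fun i : I => i.2.1 l = c : Finset I)) :=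
          sum_measureReal_preimage_singleton _ fun i _ => hT (hqs i)
      _ = μ.real (q ⁻¹' (univ.filter fun i : I => i.1 = c : Finset I)) := by
          congr 1
          ext x
          simp [q]
      _ = _ := (sum_measureReal_preimage_singleton _ fun i _ => hqs i).symm
  obtain ⟨τ, hτ⟩ := S.exists_perm hmass0 hr hw (fun i : I => i.1) (fun i => i.2.1 l) (s l) (good l)
    fun c => by convert hdemand c
  -- The operator Φ(T) evaluates at T⁻¹y; τ imitates T l⁻¹, so τ⁻¹ imitates T l.
  refine ⟨(τ⁻¹ : Equiv.Perm S.J), fun C hC => ?_⟩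
  let inRange : S.J → Prop := fun j =>
    0 ≤ S.scale j + s l (S.cell j) ∧ S.scale j + s l (S.cell j) < M
  let G : Finset S.J := univ.filter fun j => good l (S.cell j) ∧ inRange j
  let B : Set X := {y | (e y).1 ∈ G}
  have hfm : Measurable fun y => (e y).1 := measurable_fst.comp e.measurable
  have hBm : MeasurableSet B := hfm (Set.to_countable (G : Set S.J)).measurableSet
  have hnear := norm_koopman_indicator_sub_sq_le (N.hom τ⁻¹) (T l) C.2 hBm (κ := (r ^ 2)⁻¹) <| by
    have hz : ∀ᵐ y ∂μ, S.cell (e (permAction e τ y)).1 = q (permAction e τ y) :=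
      (N.hom τ).2.1.ae heq
    filter_upwards [heq, hz, hspec l, rnDeriv_permAut hSpos hSsum he τ⁻¹] with y h1 h2 h3 h4 hy
    obtain ⟨hg, hr1, hr2⟩ := (mem_filter.1 hy).2
    obtain ⟨h5, h6⟩ := hτ _ hg hr1 hr2
    have hinv : ((N.hom τ⁻¹ : nonsingularGroup μ) : Equiv.Perm X)⁻¹ y = permAction e τ y := by
      have : ((N.hom τ⁻¹ : nonsingularGroup μ) : Equiv.Perm X) = permAction e τ⁻¹ := rfl
      rw [this, map_inv, inv_inv]
    rw [hinv]
    constructor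
    · rw [fst_permAction] at h2
      rw [h2, h1] at h5
      have h7 := congrFun h5 ⟨C, hC⟩
      exact iff_of_eq h7
    · change _ ≤ ((μ.map (permAut hSpos hSsum he τ⁻¹ : Equiv.Perm X)).rnDeriv μ y).toReal
      rw [h4, inv_inv]
      rw [h1] at hg h6
      rw [(hgood l y hg).2] at h6
      rw [le_div_iff₀ (hSpos _)]
      refine le_trans ?_ h6
      have h8 := hSpos (e y).1
      gcongr
      -- The density is at most r^(s+2) and the mass ratio at least r^(s−1); κ = r⁻², of square r⁻⁴,
      -- bridges this gap.
      calc ((r ^ 2)⁻¹) ^ 2 * ρ l y ≤ ((r ^ 2)⁻¹) ^ 2 * r ^ (s₀ l y + 2) := by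
            gcongr; exact h3.2
        _ = r ^ (s₀ l y - 2) := by
            have : ((r ^ 2)⁻¹) ^ 2 = r ^ (-4 : ℤ) := by
              rw [← inv_pow, ← pow_mul, ← inv_zpow', ]; norm_cast
            rw [this, ← zpow_add₀ hr0.ne']
            congr 1
            ring
        _ ≤ _ := zpow_le_zpow_right₀ hr.le (by omega)
  refine hnear.trans ?_
  let out : Finset S.J := univ.filter fun j => ¬ inRange j
  let B₂ : Set X := {y | |s₀ l y| ≤ L ∧ (e y).1 ∈ out}
  have hlm : MeasurableSet {y | |s₀ l y| ≤ L} :=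
    (hs₀m l) (Set.to_countable {k : ℤ | |k| ≤ L}).measurableSet
  have hB₂m : MeasurableSet B₂ :=
    hlm.inter (hfm (Set.to_countable (out : Set S.J)).measurableSet)
  have hB₂ : μ.real ((T l : Equiv.Perm X) ⁻¹' B₂) ≤ ε / 8 := by
    have h1 : μ.real B₂ ≤ L / M := by
      calc μ.real B₂ ≤ μ.real {y | (e y).1 ∈ out} := measureReal_mono fun y hy => hy.2
        _ = ∑ j ∈ out, S.m j := measureReal_fst_mem hSpos he out
        _ ≤ L / M * ∑ i, mass i := by
            convert S.sum_out_of_range_le hmass0 (s l) (hsL l)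
        _ = L / M := by rw [hmass1, mul_one]
    refine (measureReal_le_mul_of_rnDeriv_le (T l) hB₂m (c := r ^ ((L : ℤ) + 2)) ?_).trans ?_
    · filter_upwards [hspec l] with y hy hyB
      refine hy.2.trans (zpow_le_zpow_right₀ hr.le ?_)
      have := (abs_le.1 hyB.1).2
      omega
    · rw [mul_comm]
      refine le_trans ?_ hMε
      gcongr
  have hBc : μ.real ((T l : Equiv.Perm X) ⁻¹' Bᶜ) ≤ ε / 8 + ε / 8 := by
    calc μ.real ((T l : Equiv.Perm X) ⁻¹' Bᶜ)
        ≤ μ.real ((T l : Equiv.Perm X) ⁻¹' {y | (L : ℤ) < |s₀ l y|} ∪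
            (T l : Equiv.Perm X) ⁻¹' B₂) := by
          refine ENNReal.toReal_mono (measure_ne_top _ _) (measure_mono_ae ?_)
          filter_upwards [(T l).2.1.ae heq] with x hx hxB
          by_cases h : |s₀ l ((T l : Equiv.Perm X) x)| ≤ L
          · refine Or.inr ⟨h, mem_filter.2 ⟨mem_univ _, fun hin => hxB ?_⟩⟩
            exact mem_filter.2 ⟨mem_univ _, by rw [hx]; exact hgood' l _ h, hin⟩
          · exact Or.inl (not_le.1 h)
      _ ≤ _ := (measureReal_union_le _ _).trans (add_le_add (hL l) hB₂)
  have hB1 : μ.real ((T l : Equiv.Perm X) ⁻¹' B) + μ.real ((T l : Equiv.Perm X) ⁻¹' Bᶜ) = 1 := by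
    rw [Set.preimage_compl, measureReal_add_measureReal_compl ((T l).2.1.measurable hBm)]
    simp
  have hκ1 : (r ^ 2)⁻¹ ≤ 1 := inv_le_one_of_one_le₀ (one_le_pow₀ hr.le)
  have hB0 : μ.real ((T l : Equiv.Perm X) ⁻¹' B) ≤ 1 := measureReal_le_one
  nlinarith [mul_nonneg (sub_nonneg.2 hκ1) (sub_nonneg.2 hB0)]

end Approximation

/-! ### Haar measure on finite images -/

section Haar

/-- The uniform probability measure on a finite type. -/
def uniformMeasure (P : Type*) [Fintype P] : @Measure P ⊤ :=
  let _ : MeasurableSpace P := ⊤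
  (Fintype.card P : ℝ≥0∞)⁻¹ • Measure.count

lemma uniformMeasure_apply {P : Type*} [Fintype P] [DecidableEq P] (s : Finset P) :
    uniformMeasure P s = ENNReal.ofReal (s.card / Fintype.card P) := by
  let _ : MeasurableSpace P := ⊤
  by_cases hP : Fintype.card P = 0
  · have : IsEmpty P := Fintype.card_eq_zero_iff.1 hP
    have : s = ∅ := Finset.eq_empty_of_isEmpty s
    subst this
    simp
  · have h1 : uniformMeasure P = (Fintype.card P : ℝ≥0∞)⁻¹ • Measure.count := rfl
    have h2 : (0 : ℝ) < Fintype.card P := Nat.cast_pos.2 (Nat.pos_of_ne_zero hP)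
    rw [h1, Measure.smul_apply, Measure.count_apply_finset, smul_eq_mul,
      ENNReal.ofReal_div_of_pos h2, ENNReal.ofReal_natCast, ENNReal.ofReal_natCast, mul_comm,
      ENNReal.div_eq_inv_mul, mul_comm]

lemma map_uniformMeasure_apply {G P : Type*} [MeasurableSpace G] [Fintype P] (φ : P → G) {V : Set G} (hV : MeasurableSet V) 
    [DecidablePred (· ∈ V)] :
    @Measure.map P G ⊤ _ φ (uniformMeasure P) V =
      ENNReal.ofReal ((Finset.univ.filter fun p => φ p ∈ V).card / Fintype.card P) := by
  classical
  let _ : MeasurableSpace P := ⊤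
  rw [Measure.map_apply measurable_from_top hV, ← uniformMeasure_apply]
  congr 1
  ext p
  simp

variable {G : Type*} [Group G] [TopologicalSpace G] [T1Space G] [MeasurableSpace G] [BorelSpace G]
  {P : Type*} [Group P] [Fintype P]

/-- Translation by φ p lifts to translation by p, which preserves the uniform measure; every point
of the image has mass at least 1/#P, so nonempty open sets are not null. -/
lemma isNormalizedHaarOn_range (φ : P →* G) :
    IsNormalizedHaarOn φ.range (@Measure.map P G ⊤ _ φ (uniformMeasure P)) := by
  classical
  let _ : MeasurableSpace P := ⊤
  have : Finite φ.range := Finite.of_surjective _ φ.rangeRestrict_surjective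
  have hm : ∀ f : P → φ.range, Measurable f := fun f => measurable_from_top
  have hprob : IsProbabilityMeasure (uniformMeasure P) := ⟨by
    rw [← Finset.coe_univ, uniformMeasure_apply, Finset.card_univ, div_self, ENNReal.ofReal_one]
    exact Nat.cast_ne_zero.2 Fintype.card_ne_zero⟩
  have hinv : ∀ p : P, (uniformMeasure P).map (p * ·) = uniformMeasure P := fun p => by
    refine Measure.ext_of_singleton fun x => ?_
    have h1 : (p * ·) ⁻¹' ({x} : Set P) = (({p⁻¹ * x} : Finset P) : Set P) := by
      ext y
      simp [eq_inv_mul_iff_mul_eq]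
    have h2 : ({x} : Set P) = (({x} : Finset P) : Set P) := by simp
    rw [Measure.map_apply measurable_from_top (measurableSet_singleton x), h1, h2,
      uniformMeasure_apply, uniformMeasure_apply]
    simp
  have hprob' : IsProbabilityMeasure ((uniformMeasure P).map φ.rangeRestrict) :=
    Measure.isProbabilityMeasure_map (hm _).aemeasurable
  refine ⟨(uniformMeasure P).map φ.rangeRestrict,
    { map_mul_left_eq_self := ?_, lt_top_of_isCompact := ?_, open_pos := ?_ }, hprob', ?_⟩
  · exact fun _ _ => measure_lt_top _ _
  · intro h
    obtain ⟨p, rfl⟩ := φ.rangeRestrict_surjective h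
    rw [Measure.map_map (measurable_of_countable _) (hm _)]
    conv_rhs => rw [← hinv p]
    rw [Measure.map_map (hm _) measurable_from_top]
    congr 1
    ext x
    simp
  · rintro U hU ⟨h, hh⟩ h0
    obtain ⟨p, rfl⟩ := φ.rangeRestrict_surjective h
    rw [Measure.map_apply (hm _) U.toFinite.measurableSet] at h0
    have h1 : uniformMeasure P (({p} : Finset P) : Set P) = 0 :=
      measure_mono_null (by simpa using hh) h0
    rw [uniformMeasure_apply, ENNReal.ofReal_eq_zero, Finset.card_singleton] at h1
    have h2 : (0 : ℝ) < Fintype.card P := Nat.cast_pos.2 Fintype.card_pos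
    have h3 : (0 : ℝ) < (1 : ℕ) / (Fintype.card P : ℝ) := by positivity
    exact absurd h1 (not_le.2 h3)
  · rw [Measure.map_map measurable_subtype_coe (hm _)]
    rfl

end Haar

/-! ### From concentrated permutations to the Lévy property and fixed points -/

section PermConcentration

open Finset

/-- A group can be approximated on finite sets by homomorphic images of symmetric groups in which
sets of non-negligible size have almost full neighbourhoods. -/
def HasConcentratedPerms (G : Type u) [Group G] [TopologicalSpace G] : Prop :=
  ∀ (F : Finset G) (U : Set G), U ∈ 𝓝 (1 : G) → ∀ c δ : ℝ, 0 < c → 0 < δ →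
    ∃ (J : Type u) (_ : Fintype J) (_ : DecidableEq J) (φ : Equiv.Perm J →* G),
      (∀ g ∈ F, ∃ τ, g * (φ τ)⁻¹ ∈ U) ∧
      ∀ A : Finset (Equiv.Perm J), c * Fintype.card (Equiv.Perm J) ≤ #A →
        open Classical in (#{σ | ∀ a ∈ A, φ σ * (φ a)⁻¹ ∉ U} : ℝ) ≤
          δ * Fintype.card (Equiv.Perm J)

theorem AutStar.hasConcentratedPerms {X : Type u} [MeasurableSpace X] [StandardBorelSpace X]
    (μ : Measure X) [IsProbabilityMeasure μ] [NullSingletonClass μ] :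
    HasConcentratedPerms (AutStar μ) := by
  classical
  intro F U hU c δ hc hδ
  obtain ⟨C₁, ε₁, hε₁, h₁⟩ := exists_finset_indicator_of_mem_nhds hU
  have hW : ∀ g : AutStar μ, {h : AutStar μ | g * h⁻¹ ∈ U} ∈ 𝓝 g := fun g => by
    have hcont : ContinuousAt (fun h : AutStar μ => g * h⁻¹) g :=
      (continuous_const.mul continuous_inv).continuousAt
    refine hcont.preimage_mem_nhds ?_
    rwa [mul_inv_cancel]
  choose C₂ ε₂ hε₂ h₂ using fun g => exists_finset_indicator_of_mem_nhds (hW g)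
  choose T hT using fun g : AutStar μ => mk_surjective g
  obtain ⟨ε, hε, hεF⟩ : ∃ ε : ℝ, 0 < ε ∧ ∀ g ∈ F, ε < ε₂ g ^ 2 := by
    have h1 : ∀ᶠ ε : ℝ in 𝓝[>] 0, ∀ g ∈ F, ε < ε₂ g ^ 2 := by
      refine (eventually_all_finset F).2 fun g _ => ?_
      exact (tendsto_id.mono_left nhdsWithin_le_nhds).eventually_lt_const (pow_pos (hε₂ g) 2)
    have h2 : ∀ᶠ ε : ℝ in 𝓝[>] 0, 0 < ε := eventually_mem_nhdsWithin
    exact (h2.and h1).exists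
  -- If b times the Hamming distance is below t, the squared norms are below 2t = ε₁². The value of
  -- η below is what `card_near_le` needs for both c and δ.
  set t : ℝ := ε₁ ^ 2 / 2 with ht
  have ht0 : 0 < t := by positivity
  obtain ⟨b, S, hb, hbη, hS⟩ := exists_permModel_near (fun g : F => T g) (F.biUnion C₂) hε
    (η := min c δ * t ^ 2 / 36) (by have := lt_min hc hδ; positivity)
  refine ⟨S.J, inferInstance, inferInstance, mk.comp S.hom, fun g hg => ?_, fun A hA => ?_⟩
  · obtain ⟨σ, hσ⟩ := hS ⟨g, hg⟩
    refine ⟨σ, h₂ g _ fun C hC => ?_⟩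
    have h3 := (hσ C (mem_biUnion.2 ⟨g, hg, hC⟩)).trans_lt (hεF g hg)
    have h4 : (g : AutStar μ).koopman = _root_.koopman (T g) := by
      rw [← koopman_mk, hT]
    rw [h4]
    exact lt_of_pow_lt_pow_left₀ 2 (hε₂ g).le h3
  · have hη1 : 36 * (b ^ 2 * Fintype.card S.J) ≤ c * t ^ 2 := by
      have : min c δ * t ^ 2 ≤ c * t ^ 2 := by gcongr; exact min_le_left _ _
      linarith
    have hη2 : 36 * (b ^ 2 * Fintype.card S.J) ≤ δ * t ^ 2 := by
      have : min c δ * t ^ 2 ≤ δ * t ^ 2 := by gcongr; exact min_le_right _ _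
      linarith
    refine le_trans ?_ (card_near_le S.J hb ht0 hc hη1 hη2 A hA)
    refine Nat.cast_le.2 (card_le_card fun σ hσ => mem_filter.2 ⟨mem_univ _, fun a ha => ?_⟩)
    by_contra! hlt
    refine (mem_filter.1 hσ).2 a ha (h₁ _ fun C _ => ?_)
    have h5 : mk.comp S.hom σ * (mk.comp S.hom a)⁻¹ = mk (S.hom (σ * a⁻¹)) := by
      rw [← map_inv, ← map_mul]; rfl
    rw [h5, koopman_mk, koopman_one]
    refine lt_of_pow_lt_pow_left₀ 2 hε₁.le ((S.norm_koopman_sub_sq_le (σ * a⁻¹) C.2).trans_lt ?_)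
    rw [permDist_mul_inv]
    linarith

variable {G : Type u} [Group G] [TopologicalSpace G]

lemma HasConcentratedPerms.exists_subgroup [T1Space G] [MeasurableSpace G] [BorelSpace G]
    (hG : HasConcentratedPerms G) (F : Finset G) {U : Set G} (hU : U ∈ 𝓝 (1 : G)) {c δ : ℝ}
    (hc : 0 < c) (hδ : 0 < δ) :
    ∃ (H : Subgroup G) (ν : Measure G), IsCompact (H : Set G) ∧ IsNormalizedHaarOn H ν ∧
      (∀ g ∈ F, ∃ h ∈ H, g * h⁻¹ ∈ U) ∧
      ∀ A V : Set G, MeasurableSet A → MeasurableSet V →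
        (∀ x, ∀ a ∈ A, x * a⁻¹ ∈ U → x ∈ V) → ENNReal.ofReal c ≤ ν A →
          1 - ENNReal.ofReal δ ≤ ν V ∧ ν V ≤ 1 := by
  classical
  obtain ⟨J, _, _, φ, h1, h2⟩ := hG F U hU c δ hc hδ
  have hN : (0 : ℝ) < Fintype.card (Equiv.Perm J) := Nat.cast_pos.2 Fintype.card_pos
  refine ⟨φ.range, @Measure.map (Equiv.Perm J) G ⊤ _ φ (uniformMeasure _), ?_,
    isNormalizedHaarOn_range φ, fun g hg => ?_, fun A V hA hV hAV hcA => ?_⟩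
  · rw [MonoidHom.coe_range]
    exact (Set.finite_range φ).isCompact
  · obtain ⟨τ, hτ⟩ := h1 g hg
    exact ⟨φ τ, ⟨τ, rfl⟩, hτ⟩
  · rw [map_uniformMeasure_apply φ hA, ENNReal.ofReal_le_ofReal_iff (by positivity),
      le_div_iff₀ hN] at hcA
    have h3 := h2 _ hcA
    rw [map_uniformMeasure_apply φ hV]
    have h4 : Fintype.card (Equiv.Perm J) ≤ #{p | φ p ∈ V} +
        #{σ | ∀ a ∈ (univ.filter fun p => φ p ∈ A), φ σ * (φ a)⁻¹ ∉ U} := by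
      rw [← card_univ]
      refine (card_le_card fun σ _ => ?_).trans (card_union_le _ _)
      by_cases hσ : φ σ ∈ V
      · exact mem_union_left _ (mem_filter.2 ⟨mem_univ _, hσ⟩)
      · refine mem_union_right _ (mem_filter.2 ⟨mem_univ _, fun a ha hau => hσ ?_⟩)
        exact hAV _ _ (mem_filter.1 ha).2 hau
    have h5 : (Fintype.card (Equiv.Perm J) : ℝ) ≤ #{p | φ p ∈ V} +
        δ * Fintype.card (Equiv.Perm J) := by
      refine le_trans (by exact_mod_cast h4) (add_le_add le_rfl h3)
    constructor
    · rw [← ENNReal.ofReal_one, ← ENNReal.ofReal_sub _ hδ.le]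
      refine ENNReal.ofReal_le_ofReal ?_
      rw [le_div_iff₀ hN]
      linarith
    · rw [← ENNReal.ofReal_one]
      refine ENNReal.ofReal_le_ofReal ?_
      rw [div_le_one hN]
      exact_mod_cast card_le_univ _

lemma IsCompatibleRightInvariant.isOpen_thickening {d : MetricSpace G}
    (hd : IsCompatibleRightInvariant d) (ε : ℝ) (A : Set G) :
    IsOpen (@Metric.thickening G d.toPseudoMetricSpace.toPseudoEMetricSpace ε A) := by
  have h := @Metric.isOpen_thickening G d.toPseudoMetricSpace.toPseudoEMetricSpace ε A
  rwa [hd.topology_eq] at h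

lemma IsCompatibleRightInvariant.ball_mem_nhds {d : MetricSpace G}
    (hd : IsCompatibleRightInvariant d) {ε : ℝ} (hε : 0 < ε) :
    {u | d.dist u 1 < ε} ∈ 𝓝 (1 : G) := by
  have h := @Metric.ball_mem_nhds G d.toPseudoMetricSpace 1 ε hε
  rwa [hd.topology_eq] at h

lemma IsCompatibleRightInvariant.dist_eq {d : MetricSpace G}
    (hd : IsCompatibleRightInvariant d) (x y : G) : d.dist x y = d.dist (x * y⁻¹) 1 := by
  rw [← hd.dist_mul_right x y y⁻¹, mul_inv_cancel]

/-- The net is indexed by pairs (finite set, n), with a neighbourhood U n and c = δ = 1/(n+1),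
independently of the metric. A positive lower limit eventually exceeds 1/(n+1), and d(x, a) =
d(xa⁻¹, 1) turns closeness modulo U n into metric closeness. -/
theorem HasConcentratedPerms.isLevyGroup [IsTopologicalGroup G] [MeasurableSpace G] [BorelSpace G]
    (hG : HasConcentratedPerms G) (hd : ∃ d : MetricSpace G, IsCompatibleRightInvariant d) :
    IsLevyGroup G := by
  classical
  have hmet : TopologicalSpace.MetrizableSpace G := by
    obtain ⟨d, hd⟩ := hd
    have h : @TopologicalSpace.MetrizableSpace G
      d.toPseudoMetricSpace.toUniformSpace.toTopologicalSpace := inferInstance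
    rwa [hd.topology_eq] at h
  refine ⟨inferInstance, hmet, hd, ?_⟩
  obtain ⟨U, hU⟩ := (𝓝 (1 : G)).exists_antitone_basis
  have hpos : ∀ n : ℕ, (0 : ℝ) < 1 / (n + 1) := fun n => by positivity
  choose H ν hH hν hF hconc using fun i : Finset G × ℕ =>
    hG.exists_subgroup i.1 (hU.1.mem_of_mem (i := i.2) trivial) (hpos i.2) (hpos i.2)
  refine ⟨Finset G × ℕ, inferInstance, inferInstance, inferInstance, H, ν, hH, hν,
    fun d hd => ⟨?_, ?_⟩⟩
  · intro A hA hlim ε hε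
    obtain ⟨n₀, -, hn₀⟩ := hU.1.mem_iff.1 (hd.ball_mem_nhds hε)
    obtain ⟨c₀, hc₀, hc₀'⟩ := exists_between hlim
    have h1 : ∀ᶠ i in atTop, c₀ < ν i (A i) := eventually_lt_of_lt_liminf hc₀'
    have hsnd : Tendsto (fun i : Finset G × ℕ => i.2) atTop atTop := by
      rw [← prod_atTop_atTop_eq]; exact tendsto_snd
    have hzero : Tendsto (fun i : Finset G × ℕ => ENNReal.ofReal (1 / ((i.2 : ℝ) + 1))) atTop
        (𝓝 0) := by
      have := ENNReal.tendsto_ofReal (tendsto_one_div_add_atTop_nhds_zero_nat (𝕜 := ℝ))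
      rw [ENNReal.ofReal_zero] at this
      exact this.comp hsnd
    have h2 : ∀ᶠ i : Finset G × ℕ in atTop, ENNReal.ofReal (1 / ((i.2 : ℝ) + 1)) < c₀ :=
      hzero.eventually_lt_const hc₀
    have h3 : ∀ᶠ i : Finset G × ℕ in atTop, n₀ ≤ i.2 := hsnd.eventually_ge_atTop n₀
    have key : ∀ᶠ i : Finset G × ℕ in atTop,
        1 - ENNReal.ofReal (1 / ((i.2 : ℝ) + 1)) ≤ ν i (@Metric.thickening G
          d.toPseudoMetricSpace.toPseudoEMetricSpace ε (A i)) ∧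
        ν i (@Metric.thickening G d.toPseudoMetricSpace.toPseudoEMetricSpace ε (A i)) ≤ 1 := by
      filter_upwards [h1, h2, h3] with i hi1 hi2 hi3
      refine hconc i (A i) _ (hA i) (hd.isOpen_thickening ε (A i)).measurableSet ?_
        (hi2.le.trans hi1.le)
      intro x a ha hxa
      refine (@Metric.mem_thickening_iff ε G d.toPseudoMetricSpace (A i) x).2 ⟨a, ha, ?_⟩
      rw [hd.dist_eq]
      exact hn₀ (hU.2 hi3 hxa)
    have hone : Tendsto (fun i : Finset G × ℕ => 1 - ENNReal.ofReal (1 / ((i.2 : ℝ) + 1))) atTop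
        (𝓝 1) := by
      simpa using ENNReal.Tendsto.sub (tendsto_const_nhds (x := (1 : ℝ≥0∞))) hzero
        (Or.inl ENNReal.one_ne_top)
    exact tendsto_of_tendsto_of_tendsto_of_le_of_le' hone tendsto_const_nhds
      (key.mono fun i hi => hi.1) (key.mono fun i hi => hi.2)
  · intro F ε hε
    obtain ⟨n₀, -, hn₀⟩ := hU.1.mem_iff.1 (hd.ball_mem_nhds hε)
    refine ⟨(F, n₀), fun j hj g hg => ?_⟩
    obtain ⟨h, hh, hgh⟩ := hF j g (hj.1 hg)
    refine ⟨h, hh, ?_⟩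
    rw [hd.dist_eq]
    exact hn₀ (hU.2 hj.2 hgh)

/-- Finitely many group elements almost fix some point of any given compact space. -/
lemma HasConcentratedPerms.exists_almost_fixed (hG : HasConcentratedPerms G) {K : Type v}
    [UniformSpace K] [CompactSpace K] [Nonempty K] [MulAction G K] [ContinuousSMul G K]
    (F : Finset G) {V : Set (K × K)} (hV : V ∈ uniformity K) :
    ∃ x : K, ∀ g ∈ F, (g • x, x) ∈ V := by
  classical
  obtain ⟨V₁, hV₁, hs₁, hc₁⟩ := comp_symm_mem_uniformity_sets hV
  obtain ⟨V₂, hV₂, hs₂, hc₂⟩ := comp_symm_mem_uniformity_sets hV₁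
  obtain ⟨W, hW, hsW, hcW⟩ := comp_symm_mem_uniformity_sets hV₂
  have hWV₂ : W ⊆ V₂ := fun z hz => hcW ⟨z.2, hz, refl_mem_uniformity hW⟩
  have hV₂V₁ : V₂ ⊆ V₁ := fun z hz => hc₂ ⟨z.2, hz, refl_mem_uniformity hV₂⟩
  -- By compactness of K, elements near 1 move all points uniformly little.
  have hU : {u : G | ∀ x : K, (u • x, x) ∈ W} ∈ 𝓝 (1 : G) := by
    have hcont : Continuous fun z : G × K => (z.1 • z.2, z.2) := by fun_prop
    have h1 : ∀ x ∈ (Set.univ : Set K), ∀ᶠ z : G × K in 𝓝 (1, x), (z.1 • z.2, z.2) ∈ W := by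
      intro x _
      refine hcont.continuousAt.preimage_mem_nhds ?_
      rw [one_smul]
      exact nhds_le_uniformity x hW
    have h2 := (isCompact_univ (X := K)).eventually_forall_of_forall_eventually
      (P := fun (u : G) (x : K) => (u • x, x) ∈ W) h1
    filter_upwards [h2] with u hu x
    exact hu x trivial
  obtain ⟨t, ht⟩ : ∃ t : Finset K, ∀ x, ∃ y ∈ t, (x, y) ∈ W := by
    have := (isCompact_univ (X := K)).totallyBounded W hW
    obtain ⟨t, htf, ht⟩ := this
    refine ⟨htf.toFinset, fun x => ?_⟩
    obtain ⟨y, hy, hxy⟩ := Set.mem_iUnion₂.1 (ht (Set.mem_univ x))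
    exact ⟨y, htf.mem_toFinset.2 hy, hxy⟩
  obtain ⟨x₀⟩ := ‹Nonempty K›
  have htpos : 0 < #t := by
    obtain ⟨y, hy, _⟩ := ht x₀
    exact card_pos.2 ⟨y, hy⟩
  have htpos' : (0 : ℝ) < #t := Nat.cast_pos.2 htpos
  -- By pigeonhole some y in t is near φ(σ)x₀ for a proportion at least 1/#t of the σ. The bound
  -- 1/(#F + 2) is chosen so that the bad set E and its #F translates cannot cover the symmetric
  -- group.
  obtain ⟨J, _, _, φ, hφ, hconc⟩ := hG F _ hU (1 / #t) (1 / (#F + 2)) (by positivity)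
    (by positivity)
  set N : ℕ := Fintype.card (Equiv.Perm J) with hN
  have hN0 : (0 : ℝ) < N := Nat.cast_pos.2 Fintype.card_pos
  obtain ⟨y, hy, hyA⟩ : ∃ y ∈ t, 1 / (#t : ℝ) * N ≤
      #{σ : Equiv.Perm J | (φ σ • x₀, y) ∈ W} := by
    by_contra! hlt
    have h1 : N ≤ ∑ y ∈ t, #{σ : Equiv.Perm J | (φ σ • x₀, y) ∈ W} := by
      rw [hN, ← card_univ]
      refine (card_le_card fun σ _ => ?_).trans card_biUnion_le
      obtain ⟨y, hy, hσ⟩ := ht (φ σ • x₀)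
      exact mem_biUnion.2 ⟨y, hy, mem_filter.2 ⟨mem_univ _, hσ⟩⟩
    have h2 : ∑ y ∈ t, (#{σ : Equiv.Perm J | (φ σ • x₀, y) ∈ W} : ℝ) <
        ∑ _y ∈ t, 1 / (#t : ℝ) * N := sum_lt_sum_of_nonempty (card_pos.1 htpos) hlt
    rw [sum_const, nsmul_eq_mul, ← mul_assoc, mul_one_div_cancel htpos'.ne', one_mul] at h2
    have h3 : (N : ℝ) ≤ ∑ y ∈ t, (#{σ : Equiv.Perm J | (φ σ • x₀, y) ∈ W} : ℝ) := by
      exact_mod_cast h1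
    exact absurd h2 (not_lt.2 h3)
  set A : Finset (Equiv.Perm J) := {σ | (φ σ • x₀, y) ∈ W} with hA
  have hbad := hconc A hyA
  set E : Finset (Equiv.Perm J) :=
    {σ | ∀ a ∈ A, φ σ * (φ a)⁻¹ ∉ {u : G | ∀ x : K, (u • x, x) ∈ W}} with hE
  have hgoodσ : ∀ σ, σ ∉ E → (φ σ • x₀, y) ∈ V₂ := by
    intro σ hσ
    have h1 : ∃ a ∈ A, φ σ * (φ a)⁻¹ ∈ {u : G | ∀ x : K, (u • x, x) ∈ W} := by
      by_contra! h
      exact hσ (mem_filter.2 ⟨mem_univ _, h⟩)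
    obtain ⟨a, ha, hau⟩ := h1
    have h2 := hau (φ a • x₀)
    rw [smul_smul, inv_mul_cancel_right] at h2
    exact hcW ⟨φ a • x₀, h2, (mem_filter.1 ha).2⟩
  choose! τ hτ using hφ
  obtain ⟨k, hk⟩ : ∃ k, k ∉ E ∪ F.biUnion fun g => E.image fun σ => (τ g)⁻¹ * σ := by
    by_contra! hall
    have h1 : N ≤ #E + #F * #E := by
      rw [hN, ← card_univ]
      refine (card_le_card fun σ _ => hall σ).trans ((card_union_le _ _).trans ?_)
      gcongr
      exact card_biUnion_le_card_mul _ _ _ fun g _ => card_image_le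
    have h2 : (N : ℝ) ≤ #E + #F * #E := by exact_mod_cast h1
    have h3 : (#E : ℝ) * (#F + 2) ≤ N := by
      rw [one_div, inv_mul_eq_div, le_div_iff₀ (by positivity)] at hbad
      exact hbad
    have h4 : (#E : ℝ) ≤ 0 := by linarith
    have h5 : (#E : ℝ) = 0 := le_antisymm h4 (Nat.cast_nonneg _)
    rw [h5] at h2
    linarith
  rw [mem_union, not_or] at hk
  -- Both φ(k)x₀ and φ(τ_g k)x₀ are near y, and g φ(k)x₀ is near the latter because g φ(τ_g)⁻¹ moves
  -- every point little.
  refine ⟨φ k • x₀, fun g hg => ?_⟩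
  have h1 : τ g * k ∉ E := fun h => hk.2 <| mem_biUnion.2 ⟨g, hg, mem_image.2
    ⟨τ g * k, h, inv_mul_cancel_left _ _⟩⟩
  have h2 := hτ g hg (φ (τ g * k) • x₀)
  have h3 : (g * (φ (τ g))⁻¹) • φ (τ g * k) • x₀ = g • φ k • x₀ := by
    rw [smul_smul, smul_smul, map_mul, mul_assoc, inv_mul_cancel_left]
  rw [h3] at h2
  have h4 : (g • φ k • x₀, y) ∈ V₁ := hc₂ ⟨_, hWV₂ h2, hgoodσ _ h1⟩
  have h5 : (y, φ k • x₀) ∈ V₁ := hV₂V₁ (hs₂.symm _ _ (hgoodσ _ hk.1))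
  exact hc₁ ⟨y, h4, h5⟩

/-- Being g-fixed up to a closed entourage is a closed condition, and finitely many such conditions
are met by an almost fixed point. Compactness gives a common point, which is fixed because K is
Hausdorff. -/
theorem HasConcentratedPerms.extremelyAmenable (hG : HasConcentratedPerms G) :
    ExtremelyAmenable.{v} G := by
  intro K _ _ _ _ _ _
  classical
  let _ : UniformSpace K := uniformSpaceOfCompactR1
  let Z : G × {V : Set (K × K) // V ∈ uniformity K ∧ IsClosed V} → Set K :=
    fun p => {x | (p.1 • x, x) ∈ p.2.1}
  have hZ : ∀ p, IsClosed (Z p) := fun p =>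
    p.2.2.2.preimage (by fun_prop : Continuous fun x : K => (p.1 • x, x))
  have hne : (⋂ p, Z p).Nonempty := by
    have h1 : (Set.univ ∩ ⋂ p, Z p).Nonempty := by
      refine isCompact_univ.inter_iInter_nonempty Z hZ fun s => ?_
      obtain ⟨x, hx⟩ := hG.exists_almost_fixed (K := K) (s.image Prod.fst)
        (V := ⋂ p ∈ s, p.2.1) ((biInter_finset_mem s).2 fun p _ => p.2.2.1)
      refine ⟨x, trivial, Set.mem_iInter₂.2 fun p hp => ?_⟩
      exact Set.mem_iInter₂.1 (hx p.1 (mem_image_of_mem _ hp)) p hp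
    simpa using h1
  obtain ⟨x, hx⟩ := hne
  refine ⟨x, fun g => eq_of_uniformity_basis uniformity_hasBasis_closed ?_⟩
  exact fun {V} hV => Set.mem_iInter.1 hx (g, ⟨V, hV⟩)

end PermConcentration

end

theorem theorem3p4 {X : Type u} [MeasurableSpace X] [StandardBorelSpace X]
    (μ : Measure X) [IsProbabilityMeasure μ] [NullSingletonClass μ] :
    IsLevyGroup (AutStar μ) ∧ ExtremelyAmenable.{v} (AutStar μ) :=
  ⟨(AutStar.hasConcentratedPerms μ).isLevyGroup AutStar.exists_isCompatibleRightInvariant,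
    (AutStar.hasConcentratedPerms μ).extremelyAmenable⟩
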